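/- Notation. Let $K$ be a number field. For a place $v$ of $K$ let $K_v$ be the completion and let $|\cdot|_v$ be normalized by $|x|_v=|\sigma_v(x)|^{[K_v:\mathbb{R}]/[K:\mathbb{Q}]}$ if $v\mid\infty$ ($\sigma_v:K\hookrightarrow\mathbb{C}$ an embedding attached to $v$), and by $|p|_v=p^{-[K_v:\mathbb{Q}_p]/[K:\mathbb{Q}]}$ if $v$ lies over the prime number $p$. For $\boldsymbol\lambda=(\lambda_0,\lambda_1)\in K^2$ put $H_v(\boldsymbol\lambda)=\max(1,|\lambda_0|_v,|\lambda_1|_v)$ and $H(\boldsymbol\lambda)=\prod_vH_v(\boldsymbol\lambda)$. For an algebraic number $x$ let $\mathrm{den}(x)$ be the least integer $n\ge1$ such that $nx$ is an algebraic integer. For $z\in\mathbb{C}$ let $\rho_1(1,z)\le\rho_2(1,z)$ be the moduli of the two roots $2z-1\pm2\sqrt{z^2-z}$ of $X^2-2(2z-1)X+1$. For $\omega\in\mathbb{Q}$ and integers $n\ge 0$ put $$\nu(\omega)=\mathrm{den}(\omega)\prod_{q\mid\mathrm{den}(\omega)}q^{1/(q-1)},\qquad \nu_n(\omega)=\mathrm{den}(\omega)^n\prod_{q\mid\mathrm{den}(\omega)}q^{\lfloor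 n/(q-1)\rfloor}$$ ($q$ runs over primes), let $G_n(\omega)$ be the greatest common divisor of the integers $\nu_n(\omega)\binom{n+k-1}{k}\binom{n-\omega-1}{n-k}$ $(0\le k\le n)$ and $\nu_n(\omega)\binom{n+k}{k}\binom{n+\omega}{n-1-k}$ $(0\le k\le n-1)$, and let $\Delta(\omega,\beta)=\nu(\omega)\,\mathrm{den}(\beta)\,\limsup_{n\to\infty}G_n(\omega)^{-1/n}$. For a place $v_0$ let $r=r(\omega,v_0)=1$, unless $v_0$ lies over a prime number $p$ dividing $\mathrm{den}(\omega)$, in which case $r=|\mathrm{den}(\omega)|_{v_0}^{-1}\,|p|_{v_0}^{-1/(p-1)}$. (If $p^2\nmid\mathrm{den}(\omega)$ this is $|p|_{v_0}^{-p/(p-1)}$.) Theorem. Let $\omega\in\mathbb{Q}\setminus\mathbb{Z}$, let $K$ be a number field, $v_0$ a place of $K$, and let $\beta\in K$ satisfy $|\beta|_{v_0}>r$. Let $(1-1/\beta)^\omega\in K_{v_0}$ be the sum of the convergent series $\sum_{k\ge0}\binom{\omega}{k}(-1/\beta)^k$. If $v_0\mid\infty$, put $$V(\beta)=-\tfrac{[K_{v_0}:\mathbb{R}]}{[K:\mathbb{Q}]}\log\rho_1(1,\sigma_{v_0}(\beta))-\log\Delta(\omega,\beta)-\sum_{v\mid\infty,\,v\ne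 v_0}\tfrac{[K_v:\mathbb{R}]}{[K:\mathbb{Q}]}\log\rho_2(1,\sigma_v(\beta)),$$ and if $v_0\nmid\infty$, put $$V(\beta)=-\log\bigl(r^2\,|\mathrm{den}(\beta)/\beta|_{v_0}\bigr)-\log\Delta(\omega,\beta)-\sum_{v\mid\infty}\tfrac{[K_v:\mathbb{R}]}{[K:\mathbb{Q}]}\log\rho_2(1,\sigma_v(\beta)).$$ Assume $V(\beta)>0$. Then for every $\varepsilon$ with $0<\varepsilon<V(\beta)$ there is a constant $H_0>0$, depending only on $\varepsilon$ and on $\omega,K,v_0,\beta$, such that every $\boldsymbol\lambda=(\lambda_0,\lambda_1)\in K^2\setminus\{0\}$ with $H(\boldsymbol\lambda)\ge H_0$ satisfies $$\bigl|\lambda_0(1-1/\beta)^\omega-\lambda_1\bigr|_{v_0}>C(\varepsilon)\,H_{v_0}(\boldsymbol\lambda)\,H(\boldsymbol\lambda)^{-\mu(\varepsilon)},$$ where, if $v_0\mid\infty$, with $g=-\tfrac{[K_{v_0}:\mathbb{R}]}{[K:\mathbb{Q}]}\bigl(\log\rho_1(1,\sigma_{v_0}(\beta))-\log\rho_2(1,\sigma_{v_0}(\beta))\bigr)$,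 $$\mu(\varepsilon)=\frac{g}{V(\beta)-\varepsilon},\qquad C(\varepsilon)=\exp\Bigl[-\Bigl(\frac{\log2}{V(\beta)-\varepsilon}+1\Bigr)\Bigr]\cdot\exp[g],$$ and, if $v_0\nmid\infty$, $$\mu(\varepsilon)=\frac{-\log\bigl(r^2\,|\mathrm{den}(\beta)/\beta|_{v_0}\bigr)}{V(\beta)-\varepsilon},\qquad C(\varepsilon)=\exp\Bigl[-\Bigl(\frac{\log2}{V(\beta)-\varepsilon}+1\Bigr)\Bigr]\cdot r^2\,|\mathrm{den}(\beta)/\beta|_{v_0}.$$ -/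

import Mathlib

open NumberField

namespace BinomPade

noncomputable section

/-! ### Denominators and the quantity `Δ(ω, β)` -/

/-- `den(x)`: the least positive integer `n` such that `n * x` is an algebraic integer. -/
def den {K : Type*} [Field K] (x : K) : ℕ :=
  sInf {n : ℕ | 1 ≤ n ∧ IsIntegral ℤ ((n : K) * x)}

/-- `ν(y) = den(y) * ∏_{q ∣ den(y)} q ^ (1 / (q - 1))`, the product being over primes `q`. -/
def nu (y : ℚ) : ℝ :=
  (y.den : ℝ) * ∏ q ∈ y.den.primeFactors, (q : ℝ) ^ ((1 : ℝ) / ((q : ℝ) - 1))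

/-- `ν_n(y) = den(y) ^ n * ∏_{q ∣ den(y)} q ^ ⌊n / (q - 1)⌋` (a prime `q` is at least `2`, so
the natural number division is by the positive integer `q - 1`). -/
def nuN (n : ℕ) (y : ℚ) : ℕ :=
  y.den ^ n * ∏ q ∈ y.den.primeFactors, q ^ (n / (q - 1))

/-- `G_n(ω)`: the greatest common divisor of the integers
`ν_n(ω) * binom(n + k - 1, k) * binom(n - ω - 1, n - k)` for `0 ≤ k ≤ n` and
`ν_n(ω) * binom(n + k, k) * binom(n + ω, n - 1 - k)` for `0 ≤ k ≤ n - 1`,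
that is, the greatest `d` such that the quotient of each of them by `d` is an integer. -/
def G (n : ℕ) (ω : ℚ) : ℕ :=
  sSup {d : ℕ | 0 < d ∧
    (∀ k : ℕ, k ≤ n → ∃ m : ℤ,
      (nuN n ω : ℚ) * Ring.choose ((n : ℚ) + k - 1) k * Ring.choose ((n : ℚ) - ω - 1) (n - k)
        = (d : ℚ) * m) ∧
    (∀ k : ℕ, k < n → ∃ m : ℤ,
      (nuN n ω : ℚ) * Ring.choose ((n : ℚ) + k) k * Ring.choose ((n : ℚ) + ω) (n - 1 - k)
        = (d : ℚ) * m)}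

/-- `Δ(ω, β) = ν(ω) * den(β) * limsup_n G_n(ω) ^ (-1 / n)`. -/
def Delta {K : Type*} [Field K] (ω : ℚ) (β : K) : ℝ :=
  nu ω * (den β : ℝ) *
    Filter.limsup (fun n : ℕ => (G n ω : ℝ) ^ (-(1 : ℝ) / (n : ℝ))) Filter.atTop

/-! ### The roots of the characteristic polynomial -/

/-- The root `2 z - α + 2 √(z² - z α)` of `X² - 2 (2 z - α) X + α²`. -/
def rootPlus (α z : ℂ) : ℂ := 2 * z - α + 2 * (z ^ 2 - z * α) ^ (1 / 2 : ℂ)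

/-- The root `2 z - α - 2 √(z² - z α)` of `X² - 2 (2 z - α) X + α²`. -/
def rootMinus (α z : ℂ) : ℂ := 2 * z - α - 2 * (z ^ 2 - z * α) ^ (1 / 2 : ℂ)

/-- The smaller of the moduli of the two roots. -/
def rho₁ (α z : ℂ) : ℝ := min ‖rootPlus α z‖ ‖rootMinus α z‖

/-- The larger of the moduli of the two roots. -/
def rho₂ (α z : ℂ) : ℝ := max ‖rootPlus α z‖ ‖rootMinus α z‖

/-! ### Places, normalized absolute values, heights -/

variable {K : Type*} [Field K] [NumberField K]

variable (K) in
/-- A place of `K` is an archimedean place or a finite place. -/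
abbrev Place : Type _ := InfinitePlace K ⊕ FinitePlace K

/-- The underlying real absolute value of a place: `x ↦ |σ_v(x)|` at an archimedean place, and
`x ↦ N(𝔭) ^ (-ord_𝔭(x))` at the place of the prime ideal `𝔭`. -/
def Place.abv : Place K → AbsoluteValue K ℝ
  | .inl v => v.1
  | .inr v => v.1

/-- The exponent that turns `Place.abv` into the absolute value `|·|_v` for which
`|x|_v = |σ_v(x)| ^ ([K_v : ℝ] / [K : ℚ])` when `v` is archimedean and
`|p|_v = p ^ (-[K_v : ℚ_p] / [K : ℚ])` when `v` lies over the prime number `p`; in the latter case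
`Place.abv` takes the value `p ^ (-[K_v : ℚ_p])` at `p`. -/
def Place.weight : Place K → ℝ
  | .inl v => (v.mult : ℝ) / (Module.finrank ℚ K : ℝ)
  | .inr _ => 1 / (Module.finrank ℚ K : ℝ)

/-- The normalized absolute value `|x|_v` of an element of `K`. -/
def Place.nabs (v : Place K) (x : K) : ℝ := v.abv x ^ v.weight

/-- The extension of the normalized absolute value `|·|_v` to the completion `K_v`. -/
def Place.nabsCompletion (v : Place K) (x : v.abv.Completion) : ℝ := ‖x‖ ^ v.weight

/-- The embedding of `K` into its completion `K_v`. -/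
def Place.coe (v : Place K) (x : K) : v.abv.Completion := ((WithAbs.toAbs v.abv x : WithAbs v.abv) :)

/-- The prime number under a finite place. -/
def residueChar (v : FinitePlace K) : ℕ := ringChar (𝓞 K ⧸ v.maximalIdeal.asIdeal)

/-- The local height `H_v(x, y) = max (1, |x|_v, |y|_v)`. -/
def localHeight (v : Place K) (x y : K) : ℝ := max 1 (max (v.nabs x) (v.nabs y))

/-- The absolute Weil height `H(x, y) = ∏_v H_v(x, y)`. -/
def height (x y : K) : ℝ :=
  (∏ v : InfinitePlace K, localHeight (Sum.inl v) x y) *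
    ∏ᶠ v : FinitePlace K, localHeight (Sum.inr v) x y

/-! ### The binomial function and the quantities in the theorem -/

/-- `(1 - 1 / β) ^ ω` in `K_v`, as the sum of the binomial series
`∑_k binom(ω, k) * (-1 / β) ^ k = ∑_k (-ω)_k / k! * β ^ (-k)`. -/
def binomValue (v : Place K) (ω : ℚ) (β : K) : v.abv.Completion :=
  ∑' k : ℕ, v.coe (((Ring.choose ω k : ℚ) : K) * (-1 / β) ^ k)

open Classical in
/-- The lower bound on `|β|_v`: it is `1`, except at a finite place over a prime number `p`
dividing `den(ω)`, where it is `|den(ω)|_v⁻¹ * |p|_v ^ (-1 / (p - 1))`. -/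
def radius (ω : ℚ) : Place K → ℝ
  | .inl _ => 1
  | .inr v =>
    if residueChar v ∣ ω.den then
      (Place.nabs (.inr v) (ω.den : K))⁻¹ *
        Place.nabs (.inr v) (residueChar v : K) ^ (-(1 : ℝ) / ((residueChar v : ℝ) - 1))
    else 1

/-- At a finite place `v`: `r ^ 2 * |den(β) / β|_v`, where `r` is the bound `radius ω v`. -/
def finiteDecay (ω : ℚ) (β : K) (v : FinitePlace K) : ℝ :=
  radius ω (Sum.inr v : Place K) ^ 2 * Place.nabs (.inr v) ((den β : K) / β)

/-- `([K_v : ℝ] / [K : ℚ]) * log ρ₁(1, σ_v(β))`. -/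
def logRho₁ (β : K) (v : InfinitePlace K) : ℝ :=
  (v.mult : ℝ) / (Module.finrank ℚ K : ℝ) * Real.log (rho₁ 1 (v.embedding β))

/-- `([K_v : ℝ] / [K : ℚ]) * log ρ₂(1, σ_v(β))`. -/
def logRho₂ (β : K) (v : InfinitePlace K) : ℝ :=
  (v.mult : ℝ) / (Module.finrank ℚ K : ℝ) * Real.log (rho₂ 1 (v.embedding β))

open Classical in
/-- The real number `V(β)`. -/
def V (ω : ℚ) (β : K) : Place K → ℝ
  | .inl v₀ => -logRho₁ β v₀ - Real.log (Delta ω β) -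
      ∑ v ∈ Finset.univ.erase v₀, logRho₂ β v
  | .inr v₀ => -Real.log (finiteDecay ω β v₀) - Real.log (Delta ω β) -
      ∑ v : InfinitePlace K, logRho₂ β v

/-- The exponent `μ(ε)`. -/
def mu (ω : ℚ) (β : K) (v₀ : Place K) (ε : ℝ) : ℝ :=
  match v₀ with
  | .inl v => -(logRho₁ β v - logRho₂ β v) / (V ω β v₀ - ε)
  | .inr v => -Real.log (finiteDecay ω β v) / (V ω β v₀ - ε)

/-- The constant `C(ε)`. -/
def C (ω : ℚ) (β : K) (v₀ : Place K) (ε : ℝ) : ℝ :=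
  Real.exp (-(Real.log 2 / (V ω β v₀ - ε) + 1)) *
    match v₀ with
    | .inl v => Real.exp (-(logRho₁ β v - logRho₂ β v))
    | .inr v => finiteDecay ω β v

end

end BinomPade

/-!
The binomial function `θ = (1 - 1 / β) ^ ω = ∑ binom(ω, m) * y ^ (-m)`, with `y = -β`, has explicit
Padé approximants at `y = ∞`. Their denominators `A_n` (`denVal`) are the Jacobi polynomials with
parameters `(-ω - 1, ω)` at `1 + 2 * y`, their numerators are `y * B_n` (`numVal`), and the
remainder `A_n θ - y B_n` is a series in `1 / y` with the explicit coefficients `remCoeff ω n m`,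
which vanish for `m < n`. The sequences `A_n`, `B_n` and the remainder satisfy one and the same
three-term recurrence (`JacobiRec`). The recurrence yields the formula for the remainder by
induction (`hasSum_remainder`), and, as `ω` is not an integer, the linear independence of two
consecutive approximants (`casoratian_ne_zero`).

Multiplied by `D_n = ν_n(ω) * den(β) ^ n / G_n(ω)`, the approximants become algebraic integers
`intDen` and `intNum`. This rests on the integrality of `ν_n(ω) * binom(ω, i)` for `i ≤ n`
(`exists_int_nuN_mul_choose`) and on `G_n(ω)` being an attained, hence positive, supremum (`G_mem`);
by the definition of `Δ(ω, β)`, the factor `D_n` is `O(exp (n * (log Δ + η)))` for every `η > 0`.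

The size of the approximants at the places of `K` is found as follows.
* At an archimedean place, the limiting characteristic polynomial of the recurrence has roots of
  moduli `ρ₁ ≤ ρ₂`, so that every solution grows at most like `ρ₂ ^ n`
  (`exists_norm_le_mul_pow_of_recurrence`). If `|β| > 1`, then `ρ₁ < 1 < ρ₂`, the remainder is
  bounded by its series, and a bounded solution must decay like `ρ₁ ^ n`
  (`exists_norm_le_mul_pow_of_bounded`).
* At a finite place, the remainder is estimated term by term: `D_n * remCoeff ω n m` is, up to the
  factor `den(β) ^ n`, a `v`-integral combination of the binomial coefficients `binom(ω, m + k)`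
  with `k ≤ n` (`coeffSum_choose`), and these are at most `r ^ (m + k)` in absolute value
  (`nabs_inr_choose_le`).

Let `L = |λ₀ θ - λ₁|`. For one of two consecutive `n`, the algebraic integer combination
`δ = λ₀ * intNum n - λ₁ * intDen n` is nonzero. Bounding `δ` at `v₀` through `L` and the remainder,
and at the other places through the size of the approximants, the product formula gives
`H_{v₀} ≤ C * exp (n * (τ + η)) * H * max (L, H_{v₀} * exp (-n * gap))`, where `τ` is the sum of the
growth rates `log Δ + ∑ log ρ₂` and `V(β) = gap - τ` (`localHeight_le`, `V_eq`). Applied to the form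
with coefficients `(1, 0)` for `n → ∞`, this shows `τ ≥ 0` (`sum_growthRate_nonneg`). Finally `η` is
taken to be `ε / 2` and `n` of size `log H / (V(β) - η)`, so that the second term of the maximum is
negligible; since `η < ε`, the resulting exponent of `H` is strictly better than `-μ(ε)`, and
this margin absorbs all constants once `H` is large.
-/

namespace BinomPade

open Filter Topology

/-! ### Generalized binomial coefficients -/

theorem choose_succ_mul (x : ℚ) (k : ℕ) :
    Ring.choose x (k + 1) * (k + 1) = (x - k) * Ring.choose x k := by
  rw [Ring.choose_eq_smul, Ring.choose_eq_smul, descPochhammer_succ_right, Polynomial.smeval_mul]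
  have h : (((k + 1).factorial : ℕ) : ℚ) = (k + 1) * (k.factorial : ℚ) := by
    rw [Nat.factorial_succ]; push_cast; ring
  simp only [smul_eq_mul, h, Polynomial.smeval_sub, Polynomial.smeval_X, pow_one,
    Polynomial.smeval_natCast, pow_zero, nsmul_eq_mul, mul_one]
  field_simp

theorem choose_succ_eq (x : ℚ) (k : ℕ) :
    Ring.choose x (k + 1) = (x - k) * Ring.choose x k / (k + 1) := by
  rw [eq_div_iff (by positivity), choose_succ_mul]

theorem add_one_choose_succ (x : ℚ) (k : ℕ) :
    Ring.choose (x + 1) (k + 1) = (x + 1) * Ring.choose x k / (k + 1) := by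
  have h := Ring.choose_succ_succ x k
  rw [h, choose_succ_eq]
  field_simp
  ring

/-! ### The coefficients of the approximants and their recurrence -/

/-- The coefficient `binom(n + k - 1, k) * binom(n - ω - 1, n - k)` of the `n`-th denominator
polynomial, in a product form that makes sense for all `k` and vanishes for `k > n`. -/
noncomputable def denCoeff (ω : ℚ) (n k : ℕ) : ℚ :=
  Ring.choose ((n : ℚ) - ω - 1) n *
    ∏ i ∈ Finset.range k, ((n : ℚ) ^ 2 - (i : ℚ) ^ 2) / (((i : ℚ) + 1) * (i - ω))

/-- The coefficient `binom(n + k, k) * binom(n + ω, n - 1 - k)` of the `n`-th numerator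
polynomial, in a product form that makes sense for all `n` and `k` and vanishes for `k ≥ n`. -/
noncomputable def numCoeff (ω : ℚ) (n k : ℕ) : ℚ :=
  (n : ℚ) / (ω + 1) * Ring.choose ((n : ℚ) + ω) n *
    ∏ i ∈ Finset.range k,
      ((n : ℚ) ^ 2 - ((i : ℚ) + 1) ^ 2) / (((i : ℚ) + 1) * (ω + i + 2))

/-- The coefficient `(-1) ^ n * binom(ω, m) * binom(n + ω, n) * binom(m, n) / binom(m + n, n)` of
`y ^ (-m)` in the `n`-th remainder. -/
noncomputable def remCoeff (ω : ℚ) (n m : ℕ) : ℚ :=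
  (-1) ^ n * Ring.choose ω m * Ring.choose ((n : ℚ) + ω) n *
    ∏ i ∈ Finset.range n, ((m : ℚ) - i) / ((m : ℚ) + 1 + i)

section Coefficients

variable {ω : ℚ}

theorem sub_intCast_ne_zero (hω : ω ∉ Set.range ((↑) : ℤ → ℚ)) (j : ℤ) : ω - j ≠ 0 := fun h =>
  hω ⟨j, by linarith⟩

theorem denCoeff_zero_succ (n : ℕ) :
    denCoeff ω (n + 1) 0 = denCoeff ω n 0 * (n - ω) / (n + 1) := by
  have h := add_one_choose_succ ((n : ℚ) - ω - 1) n
  simp only [denCoeff, Finset.range_zero, Finset.prod_empty, mul_one]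
  rw [show ((n + 1 : ℕ) : ℚ) - ω - 1 = (n : ℚ) - ω - 1 + 1 by push_cast; ring, h]
  ring

theorem add_choose_succ (n : ℕ) : Ring.choose (((n + 1 : ℕ) : ℚ) + ω) (n + 1) =
    Ring.choose ((n : ℚ) + ω) n * (n + 1 + ω) / (n + 1) := by
  have h := add_one_choose_succ ((n : ℚ) + ω) n
  rw [show ((n + 1 : ℕ) : ℚ) + ω = (n : ℚ) + ω + 1 by push_cast; ring, h]
  ring

theorem denCoeff_succ (n k : ℕ) : denCoeff ω n (k + 1) =
    denCoeff ω n k * (((n : ℚ) ^ 2 - (k : ℚ) ^ 2) / (((k : ℚ) + 1) * (k - ω))) := by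
  rw [denCoeff, Finset.prod_range_succ, denCoeff, mul_assoc]

theorem numCoeff_succ (n k : ℕ) : numCoeff ω n (k + 1) =
    numCoeff ω n k * (((n : ℚ) ^ 2 - ((k : ℚ) + 1) ^ 2) / (((k : ℚ) + 1) * (ω + k + 2))) := by
  rw [numCoeff, Finset.prod_range_succ, numCoeff, ← mul_assoc]

theorem denCoeff_eq_zero {n k : ℕ} (h : n < k) : denCoeff ω n k = 0 := by
  rw [denCoeff, Finset.prod_eq_zero (Finset.mem_range.2 h) (by simp), mul_zero]

theorem numCoeff_eq_zero {n k : ℕ} (h : n ≤ k) : numCoeff ω n k = 0 := by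
  rcases n with _ | n
  · simp [numCoeff]
  · rw [numCoeff, Finset.prod_eq_zero (Finset.mem_range.2 (show n < k by omega)) (by simp),
      mul_zero]

theorem remCoeff_eq_zero {n m : ℕ} (h : m < n) : remCoeff ω n m = 0 := by
  rw [remCoeff, Finset.prod_eq_zero (Finset.mem_range.2 h) (by simp), mul_zero]

theorem denCoeff_eq (hω : ω ∉ Set.range ((↑) : ℤ → ℚ)) {n k : ℕ} (h : k ≤ n) :
    denCoeff ω n k =
      Ring.choose ((n : ℚ) + k - 1) k * Ring.choose ((n : ℚ) - ω - 1) (n - k) := by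
  induction k with
  | zero => simp [denCoeff]
  | succ k ih =>
    rw [denCoeff_succ, ih (by omega)]
    obtain ⟨j, rfl⟩ : ∃ j, n = k + 1 + j := ⟨n - (k + 1), by omega⟩
    have e1 := add_one_choose_succ (((k + 1 + j : ℕ) : ℚ) + k - 1) k
    rw [show k + 1 + j - k = j + 1 by omega, show k + 1 + j - (k + 1) = j by omega,
      show ((k + 1 + j : ℕ) : ℚ) + (k + 1 : ℕ) - 1 = ((k + 1 + j : ℕ) : ℚ) + k - 1 + 1 by
        push_cast; ring, e1, choose_succ_eq _ j]
    have h3 : (k : ℚ) - ω ≠ 0 := fun h => sub_intCast_ne_zero hω k (by push_cast; linarith)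
    push_cast
    field_simp
    ring

theorem numCoeff_eq (hω : ω ∉ Set.range ((↑) : ℤ → ℚ)) {n k : ℕ} (h : k < n) :
    numCoeff ω n k =
      Ring.choose ((n : ℚ) + k) k * Ring.choose ((n : ℚ) + ω) (n - 1 - k) := by
  induction k with
  | zero =>
    obtain ⟨n, rfl⟩ : ∃ j, n = j + 1 := ⟨n - 1, by omega⟩
    have h3 : ω + 1 ≠ 0 := fun h => sub_intCast_ne_zero hω (-1) (by push_cast; linarith)
    have h1 : (n + 1 : ℚ) ≠ 0 := by positivity
    have e := choose_succ_eq (((n + 1 : ℕ) : ℚ) + ω) n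
    simp only [numCoeff, Finset.range_zero, Finset.prod_empty, mul_one, e, Ring.choose_zero_right,
      one_mul, Nat.add_sub_cancel, Nat.sub_zero]
    push_cast
    field_simp
    ring
  | succ k ih =>
    rw [numCoeff_succ, ih (by omega)]
    obtain ⟨j, rfl⟩ : ∃ j, n = k + 1 + j + 1 := ⟨n - (k + 2), by omega⟩
    have e1 := add_one_choose_succ (((k + 1 + j + 1 : ℕ) : ℚ) + k) k
    rw [show k + 1 + j + 1 - 1 - k = j + 1 by omega, show k + 1 + j + 1 - 1 - (k + 1) = j by omega,
      show ((k + 1 + j + 1 : ℕ) : ℚ) + (k + 1 : ℕ) = ((k + 1 + j + 1 : ℕ) : ℚ) + k + 1 by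
        push_cast; ring, e1, choose_succ_eq _ j]
    have h1 : (k + 1 : ℚ) ≠ 0 := by positivity
    have h3 : ω + k + 2 ≠ 0 := fun h =>
      sub_intCast_ne_zero hω (-k - 2) (by push_cast; linarith)
    push_cast
    field_simp
    ring

theorem prod_sq_sub_sq_add_one (x : ℚ) (k : ℕ) :
    x * ∏ i ∈ Finset.range (k + 1), ((x + 1) ^ 2 - (i : ℚ) ^ 2) =
      (x + 1) * (x + k) * (x + k + 1) * ∏ i ∈ Finset.range k, (x ^ 2 - (i : ℚ) ^ 2) := by
  induction k with
  | zero => simp; ring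
  | succ k ih =>
    rw [Finset.prod_range_succ, ← mul_assoc, ih, Finset.prod_range_succ _ k]
    push_cast
    ring

theorem prod_sq_sub_sq_sub_one (x : ℚ) (k : ℕ) :
    x * ∏ i ∈ Finset.range (k + 1), ((x - 1) ^ 2 - (i : ℚ) ^ 2) =
      (x - 1) * (x - k) * (x - k - 1) * ∏ i ∈ Finset.range k, (x ^ 2 - (i : ℚ) ^ 2) := by
  induction k with
  | zero => simp; ring
  | succ k ih =>
    rw [Finset.prod_range_succ, ← mul_assoc, ih, Finset.prod_range_succ _ k]
    push_cast
    ring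

theorem mul_prod_sq_sub_sq_add_one (x : ℚ) (k : ℕ) :
    (x + 1) * ∏ i ∈ Finset.range (k + 1), ((x + 1) ^ 2 - ((i : ℚ) + 1) ^ 2) =
      (x + k + 1) * (x + k + 2) *
        (x * ∏ i ∈ Finset.range k, (x ^ 2 - ((i : ℚ) + 1) ^ 2)) := by
  induction k with
  | zero => simp; ring
  | succ k ih =>
    rw [Finset.prod_range_succ, ← mul_assoc, ih, Finset.prod_range_succ _ k]
    push_cast
    ring

theorem mul_prod_sq_sub_sq_sub_one (x : ℚ) (k : ℕ) :
    (x - 1) * ∏ i ∈ Finset.range (k + 1), ((x - 1) ^ 2 - ((i : ℚ) + 1) ^ 2) =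
      (x - k - 1) * (x - k - 2) *
        (x * ∏ i ∈ Finset.range k, (x ^ 2 - ((i : ℚ) + 1) ^ 2)) := by
  induction k with
  | zero => simp; ring
  | succ k ih =>
    rw [Finset.prod_range_succ, ← mul_assoc, ih, Finset.prod_range_succ _ k]
    push_cast
    ring

theorem denCoeff_recurrence_zero (n : ℕ) :
    ((n : ℚ) + 1) * (n + 2) * (2 * n + 1) * denCoeff ω (n + 2) 0 =
      (n + 1) * ((2 * n + 1) * (2 * n + 3) + 2 * ω + 1) * denCoeff ω (n + 1) 0 -
        (n - ω) * (n + 1 + ω) * (2 * n + 3) * denCoeff ω n 0 := by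
  rw [denCoeff_zero_succ (n + 1), denCoeff_zero_succ n]
  push_cast
  field_simp
  ring

theorem denCoeff_recurrence_succ (hω : ω ∉ Set.range ((↑) : ℤ → ℚ)) (n k : ℕ) :
    ((n : ℚ) + 1) * (n + 2) * (2 * n + 1) * denCoeff ω (n + 2) (k + 1) =
      (n + 1) * ((2 * n + 1) * (2 * n + 3) + 2 * ω + 1) * denCoeff ω (n + 1) (k + 1) +
      (n + 1) * ((2 * n + 1) * (2 * n + 3) * 2) * denCoeff ω (n + 1) k -
        (n - ω) * (n + 1 + ω) * (2 * n + 3) * denCoeff ω n (k + 1) := by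
  have key : ∀ (m j : ℕ), denCoeff ω m j = denCoeff ω m 0 *
      (∏ i ∈ Finset.range j, ((m : ℚ) ^ 2 - (i : ℚ) ^ 2)) /
        ∏ i ∈ Finset.range j, (((i : ℚ) + 1) * (i - ω)) := by
    intro m j
    simp only [denCoeff, Finset.range_zero, Finset.prod_empty, Finset.prod_div_distrib]
    ring
  rw [key _ (k + 1), key _ (k + 1), key _ (k + 1), key _ k, denCoeff_zero_succ (n + 1),
    denCoeff_zero_succ n]
  have p1 := prod_sq_sub_sq_add_one ((n : ℚ) + 1) k
  have p2 := prod_sq_sub_sq_sub_one ((n : ℚ) + 1) k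
  have h1 : (n + 1 : ℚ) ≠ 0 := by positivity
  have h4 : (k : ℚ) - ω ≠ 0 := fun h => sub_intCast_ne_zero hω k (by push_cast; linarith)
  rw [mul_comm, ← eq_div_iff h1] at p1 p2
  rw [show (n : ℚ) + 1 - 1 = n by ring] at p2
  rw [show (((n + 2 : ℕ)) : ℚ) = n + 1 + 1 by push_cast; ring, p1, p2,
    Finset.prod_range_succ _ k, Finset.prod_range_succ _ k]
  push_cast
  generalize ∏ i ∈ Finset.range k, (((i : ℚ) + 1) * (i - ω)) = D at *
  generalize ∏ i ∈ Finset.range k, (((n : ℚ) + 1) ^ 2 - (i : ℚ) ^ 2) = P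
  field_simp
  ring

theorem numCoeff_recurrence_zero (n : ℕ) :
    ((n : ℚ) + 1) * (n + 2) * (2 * n + 1) * numCoeff ω (n + 2) 0 =
      (n + 1) * ((2 * n + 1) * (2 * n + 3) + 2 * ω + 1) * numCoeff ω (n + 1) 0 -
        (n - ω) * (n + 1 + ω) * (2 * n + 3) * numCoeff ω n 0 := by
  simp only [numCoeff, Finset.range_zero, Finset.prod_empty, mul_one]
  rw [add_choose_succ (n + 1), add_choose_succ n]
  push_cast
  field_simp
  ring

theorem numCoeff_recurrence_succ (hω : ω ∉ Set.range ((↑) : ℤ → ℚ)) (n k : ℕ) :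
    ((n : ℚ) + 1) * (n + 2) * (2 * n + 1) * numCoeff ω (n + 2) (k + 1) =
      (n + 1) * ((2 * n + 1) * (2 * n + 3) + 2 * ω + 1) * numCoeff ω (n + 1) (k + 1) +
      (n + 1) * ((2 * n + 1) * (2 * n + 3) * 2) * numCoeff ω (n + 1) k -
        (n - ω) * (n + 1 + ω) * (2 * n + 3) * numCoeff ω n (k + 1) := by
  have p1 := mul_prod_sq_sub_sq_add_one ((n : ℚ) + 1) k
  have p2 := mul_prod_sq_sub_sq_sub_one ((n : ℚ) + 1) k
  have key : ∀ (m j : ℕ), numCoeff ω m j = Ring.choose ((m : ℚ) + ω) m / (ω + 1) *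
      ((m : ℚ) * ∏ i ∈ Finset.range j, ((m : ℚ) ^ 2 - ((i : ℚ) + 1) ^ 2)) /
        ∏ i ∈ Finset.range j, (((i : ℚ) + 1) * (ω + i + 2)) := by
    intro m j
    simp only [numCoeff, Finset.prod_div_distrib]
    ring
  simp only [key]
  rw [add_choose_succ (n + 1), add_choose_succ n]
  have h4 : ω + k + 2 ≠ 0 := fun h =>
      sub_intCast_ne_zero hω (-k - 2) (by push_cast; linarith)
  rw [show (((n + 2 : ℕ)) : ℚ) = n + 1 + 1 by push_cast; ring, p1]
  rw [show (n : ℚ) + 1 - 1 = n by ring] at p2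
  rw [p2,
    Finset.prod_range_succ _ k, Finset.prod_range_succ _ k]
  push_cast
  generalize ∏ i ∈ Finset.range k, (((i : ℚ) + 1) * (ω + i + 2)) = D at *
  generalize ∏ i ∈ Finset.range k, (((n : ℚ) + 1) ^ 2 - ((i : ℚ) + 1) ^ 2) = P
  field_simp
  ring

/-- The shift of `m` in the coefficients of the remainder. -/
theorem prod_sub_div_add_succ (n m : ℕ) :
    ∏ i ∈ Finset.range (n + 1), (((m + 1 : ℕ) : ℚ) - i) / (((m + 1 : ℕ) : ℚ) + 1 + i) =
      (m + 1) ^ 2 / ((m + n + 1) * (m + n + 2)) *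
        ∏ i ∈ Finset.range n, ((m : ℚ) - i) / ((m : ℚ) + 1 + i) := by
  induction n with
  | zero =>
    simp
    have h1 : (m + 1 : ℚ) ≠ 0 := by positivity
    field_simp
    ring
  | succ n ih =>
    rw [Finset.prod_range_succ, ih, Finset.prod_range_succ _ n]
    have h1 : (m + 1 + n : ℚ) ≠ 0 := by positivity
    push_cast
    generalize ∏ i ∈ Finset.range n, ((m : ℚ) - i) / ((m : ℚ) + 1 + i) = P
    field_simp
    ring

/-- The recurrence of the coefficients of the remainder is that of the coefficients of the
approximants, with the opposite shift, as the remainder is a series in `1 / y`. -/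
theorem remCoeff_recurrence (n m : ℕ) :
    ((n : ℚ) + 1) * (n + 2) * (2 * n + 1) * remCoeff ω (n + 2) m =
      (n + 1) * ((2 * n + 1) * (2 * n + 3) + 2 * ω + 1) * remCoeff ω (n + 1) m +
      (n + 1) * ((2 * n + 1) * (2 * n + 3) * 2) * remCoeff ω (n + 1) (m + 1) -
        (n - ω) * (n + 1 + ω) * (2 * n + 3) * remCoeff ω n m := by
  simp only [remCoeff]
  rw [prod_sub_div_add_succ, choose_succ_eq ω m, add_choose_succ (n + 1), add_choose_succ n,
    Finset.prod_range_succ _ (n + 1), Finset.prod_range_succ _ n]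
  push_cast
  generalize ∏ i ∈ Finset.range n, ((m : ℚ) - i) / ((m : ℚ) + 1 + i) = P
  rw [pow_succ, pow_succ]
  field_simp
  ring

end Coefficients

/-! ### The approximants and the remainder -/

section Approximants

variable {F : Type*} [Field F] {ω : ℚ}

/-- The linear functional `y ^ k ↦ g k` applied to the polynomial `∑ c k * y ^ k` of degree at
most `n`. -/
def coeffSum (c : ℕ → ℚ) (n : ℕ) (g : ℕ → F) : F :=
  ∑ k ∈ Finset.range (n + 1), (c k : F) * g k

/-- The denominator `A_n` of the `n`-th approximant, evaluated at `y`. -/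
noncomputable def denVal (ω : ℚ) (y : F) (n : ℕ) : F := coeffSum (denCoeff ω n) n (y ^ ·)

/-- The numerator of the `n`-th approximant divided by `y`, evaluated at `y`. -/
noncomputable def numVal (ω : ℚ) (y : F) (n : ℕ) : F := coeffSum (numCoeff ω n) n (y ^ ·)

/-- The three-term recurrence of the Jacobi polynomials with parameters `(-ω - 1, ω)` at
`1 + 2 * y`. -/
def JacobiRec (ω : ℚ) (y : F) (u : ℕ → F) : Prop :=
  ∀ n : ℕ, ((n : F) + 1) * (n + 2) * (2 * n + 1) * u (n + 2) =
    (n + 1) * ((2 * n + 1) * (2 * n + 3) * (1 + 2 * y) + 2 * ω + 1) * u (n + 1) -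
      (n - ω) * (n + 1 + ω) * (2 * n + 3) * u n

/-- A recurrence of coefficients, applied under an arbitrary functional `y ^ k ↦ g k`:
multiplication by `y` becomes the shift of `g`. -/
theorem coeffSum_recurrence [CharZero F] (c : ℕ → ℕ → ℚ) (hc : ∀ n k, n < k → c n k = 0)
    (h0 : ∀ n : ℕ, ((n : ℚ) + 1) * (n + 2) * (2 * n + 1) * c (n + 2) 0 =
      (n + 1) * ((2 * n + 1) * (2 * n + 3) + 2 * ω + 1) * c (n + 1) 0 -
        (n - ω) * (n + 1 + ω) * (2 * n + 3) * c n 0)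
    (h1 : ∀ n k : ℕ, ((n : ℚ) + 1) * (n + 2) * (2 * n + 1) * c (n + 2) (k + 1) =
      (n + 1) * ((2 * n + 1) * (2 * n + 3) + 2 * ω + 1) * c (n + 1) (k + 1) +
      (n + 1) * ((2 * n + 1) * (2 * n + 3) * 2) * c (n + 1) k -
        (n - ω) * (n + 1 + ω) * (2 * n + 3) * c n (k + 1))
    (g : ℕ → F) (n : ℕ) :
    ((n : F) + 1) * (n + 2) * (2 * n + 1) * coeffSum (c (n + 2)) (n + 2) g =
      (n + 1) * ((2 * n + 1) * (2 * n + 3) + 2 * ω + 1) * coeffSum (c (n + 1)) (n + 1) g +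
      (n + 1) * ((2 * n + 1) * (2 * n + 3) * 2) *
        coeffSum (c (n + 1)) (n + 1) (fun k => g (k + 1)) -
      (n - ω) * (n + 1 + ω) * (2 * n + 3) * coeffSum (c n) n g := by
  have ext : ∀ j, j ≤ n + 2 → coeffSum (c j) j g =
      (c j 0 : F) * g 0 + ∑ k ∈ Finset.range (n + 2), (c j (k + 1) : F) * g (k + 1) := by
    intro j hj
    rw [add_comm, ← Finset.sum_range_succ' (fun k => (c j k : F) * g k)]
    refine Finset.sum_subset (Finset.range_mono (by omega)) fun k _ hk => ?_
    rw [hc j k (by simpa [Nat.lt_succ_iff] using hk), Rat.cast_zero, zero_mul]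
  rw [ext _ le_rfl, ext (n + 1) (by omega), ext n (by omega), coeffSum]
  have h0' := congrArg (Rat.cast (K := F)) (h0 n)
  have h1' := fun k => congrArg (Rat.cast (K := F)) (h1 n k)
  push_cast at h0' h1'
  have hs := Finset.sum_congr (rfl : Finset.range (n + 2) = _) fun k _ =>
    congrArg (· * g (k + 1)) (h1' k)
  simp only [sub_mul, add_mul, Finset.sum_sub_distrib, Finset.sum_add_distrib, mul_assoc,
    ← Finset.mul_sum] at hs
  simp only [mul_assoc, mul_add, add_mul, sub_mul] at h0' hs ⊢
  linear_combination hs + g 0 * h0'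

theorem denVal_rec [CharZero F] (hω : ω ∉ Set.range ((↑) : ℤ → ℚ)) (y : F) :
    JacobiRec ω y (denVal ω y) := by
  intro n
  have h := coeffSum_recurrence (denCoeff ω) (fun _ _ => denCoeff_eq_zero)
    denCoeff_recurrence_zero (denCoeff_recurrence_succ hω) (fun k => y ^ k) n
  have hy : coeffSum (denCoeff ω (n + 1)) (n + 1) (fun k => y ^ (k + 1)) =
      y * denVal ω y (n + 1) := by
    simp only [denVal, coeffSum, Finset.mul_sum]
    exact Finset.sum_congr rfl fun k _ => by ring
  rw [hy] at h
  simp only [denVal] at h ⊢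
  rw [h]
  ring

theorem numVal_rec [CharZero F] (hω : ω ∉ Set.range ((↑) : ℤ → ℚ)) (y : F) :
    JacobiRec ω y (numVal ω y) := by
  intro n
  have h := coeffSum_recurrence (numCoeff ω) (fun _ _ h => numCoeff_eq_zero h.le)
    numCoeff_recurrence_zero (numCoeff_recurrence_succ hω) (fun k => y ^ k) n
  have hy : coeffSum (numCoeff ω (n + 1)) (n + 1) (fun k => y ^ (k + 1)) =
      y * numVal ω y (n + 1) := by
    simp only [numVal, coeffSum, Finset.mul_sum]
    exact Finset.sum_congr rfl fun k _ => by ring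
  rw [hy] at h
  simp only [numVal] at h ⊢
  rw [h]
  ring

theorem ne_zero_of_notMem_range (hω : ω ∉ Set.range ((↑) : ℤ → ℚ)) : ω ≠ 0 := by
  simpa using sub_intCast_ne_zero hω 0

theorem add_one_ne_zero_of_notMem_range (hω : ω ∉ Set.range ((↑) : ℤ → ℚ)) : ω + 1 ≠ 0 := by
  simpa using sub_intCast_ne_zero hω (-1)

theorem denCoeff_one_one (hω : ω ∉ Set.range ((↑) : ℤ → ℚ)) : denCoeff ω 1 1 = 1 := by
  have h := ne_zero_of_notMem_range hω
  simp [denCoeff, h]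

theorem coeffSum_denCoeff_one (hω : ω ∉ Set.range ((↑) : ℤ → ℚ)) (g : ℕ → F) :
    coeffSum (denCoeff ω 1) 1 g = g 1 - ω * g 0 := by
  rw [coeffSum, Finset.sum_range_succ, Finset.sum_range_one, denCoeff_one_one hω]
  simp [denCoeff]
  ring

theorem denVal_zero (y : F) : denVal ω y 0 = 1 := by
  simp [denVal, coeffSum, denCoeff]

theorem denVal_one (hω : ω ∉ Set.range ((↑) : ℤ → ℚ)) (y : F) : denVal ω y 1 = y - ω := by
  rw [denVal, coeffSum_denCoeff_one hω]; simp

theorem numVal_zero (y : F) : numVal ω y 0 = 0 := by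
  simp [numVal, coeffSum, numCoeff]

theorem numVal_one (hω : ω ∉ Set.range ((↑) : ℤ → ℚ)) (y : F) : numVal ω y 1 = 1 := by
  have h := add_one_ne_zero_of_notMem_range hω
  have h' : numCoeff ω 1 0 = 1 := by
    simp only [numCoeff, Nat.cast_one, Finset.range_zero, Finset.prod_empty, mul_one,
      Ring.choose_one_right]
    field_simp
    ring
  rw [numVal, coeffSum, Finset.sum_range_succ, Finset.sum_range_one,
    numCoeff_eq_zero (ω := ω) (le_refl 1), h']
  simp

theorem remCoeff_zero (m : ℕ) : remCoeff ω 0 m = Ring.choose ω m := by simp [remCoeff]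

theorem remCoeff_one (m : ℕ) :
    remCoeff ω 1 m = Ring.choose ω (m + 1) - ω * Ring.choose ω m := by
  rw [choose_succ_eq]
  simp [remCoeff]
  field_simp
  ring

/-- Orthogonality in moment form: the coefficients of the remainder are obtained from those of the
denominator and the binomial series. -/
theorem coeffSum_choose (hω : ω ∉ Set.range ((↑) : ℤ → ℚ)) (n : ℕ) : ∀ m : ℕ,
    coeffSum (denCoeff ω n) n (fun k => Ring.choose ω (m + k)) = remCoeff ω n m := by
  induction n using Nat.twoStepInduction with
  | zero => intro m; simp [coeffSum, denCoeff, remCoeff_zero]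
  | one => intro m; rw [coeffSum_denCoeff_one hω, remCoeff_one]; simp
  | more n ih0 ih1 =>
    intro m
    have h := coeffSum_recurrence (denCoeff ω) (fun _ _ => denCoeff_eq_zero)
      denCoeff_recurrence_zero (denCoeff_recurrence_succ hω)
      (fun k => Ring.choose ω (m + k)) n
    have hs := ih1 (m + 1)
    simp only [add_assoc, add_comm 1] at hs
    rw [ih0, ih1, hs] at h
    have h' := remCoeff_recurrence (ω := ω) n m
    simp only [Rat.cast_id] at h
    have hn : ((n : ℚ) + 1) * (n + 2) * (2 * n + 1) ≠ 0 := by positivity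
    exact mul_left_cancel₀ hn (h.trans h'.symm)

/-- Approximation property: wherever the binomial series converges, the remainder is given by a
series in `1 / y` with coefficients `remCoeff`, hence beginning with `y ^ (-n)`. -/
theorem hasSum_remainder [CharZero F] [TopologicalSpace F] [IsTopologicalRing F]
    (hω : ω ∉ Set.range ((↑) : ℤ → ℚ)) {y θ : F} (hy : y ≠ 0)
    (hθ : HasSum (fun m : ℕ => ((Ring.choose ω m : ℚ) : F) * y⁻¹ ^ m) θ) (n : ℕ) :
    HasSum (fun m : ℕ => (remCoeff ω n m : F) * y⁻¹ ^ m)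
      (denVal ω y n * θ - y * numVal ω y n) := by
  have congr : ∀ {f g : ℕ → F} {s t : F}, HasSum f s → (∀ m, g m = f m) → t = s →
      HasSum g t := fun h hf hs => by rw [hs, funext hf]; exact h
  have shift : ∀ (n : ℕ) (s : F),
      HasSum (fun m : ℕ => (remCoeff ω n m : F) * y⁻¹ ^ m) s →
      HasSum (fun m : ℕ => (remCoeff ω n (m + 1) : F) * y⁻¹ ^ m)
        (y * (s - (remCoeff ω n 0 : F))) := by
    intro n s hs
    have h := ((hasSum_nat_add_iff' 1).2 hs).mul_left y
    simp only [Finset.sum_range_one, pow_zero, mul_one] at h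
    refine congr h (fun m => ?_) rfl
    rw [pow_succ]
    field_simp
  induction n using Nat.twoStepInduction with
  | zero => simpa [denVal_zero, numVal_zero, remCoeff_zero] using hθ
  | one =>
    have h := (shift 0 θ (by simpa [remCoeff_zero] using hθ)).sub (hθ.mul_left (ω : F))
    refine congr h (fun m => ?_) ?_
    · rw [remCoeff_one, remCoeff_zero]
      push_cast
      ring
    · rw [denVal_one hω, numVal_one hω, remCoeff_zero, Ring.choose_zero_right]
      push_cast
      ring
  | more n ih0 ih1 =>
    have h2 := shift (n + 1) _ ih1
    have hn : ((n : F) + 1) * (n + 2) * (2 * n + 1) ≠ 0 := by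
      have : ((n : F) + 1) * (n + 2) * (2 * n + 1) =
        (((n + 1) * (n + 2) * (2 * n + 1) : ℕ) : F) := by push_cast; ring
      rw [this]
      exact Nat.cast_ne_zero.2 (by positivity)
    have h := (((ih1.mul_left (((n : F) + 1) * ((2 * n + 1) * (2 * n + 3) + 2 * ω + 1))).add
      (h2.mul_left (((n : F) + 1) * ((2 * n + 1) * (2 * n + 3) * 2)))).sub
      (ih0.mul_left (((n : F) - ω) * (n + 1 + ω) * (2 * n + 3)))).mul_left
        (((n : F) + 1) * (n + 2) * (2 * n + 1))⁻¹
    refine congr h (fun m => ?_) ?_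
    · have := congrArg (Rat.cast (K := F)) (remCoeff_recurrence (ω := ω) n m)
      push_cast at this
      rw [eq_inv_mul_iff_mul_eq₀ hn]
      linear_combination y⁻¹ ^ m * this
    · rw [eq_inv_mul_iff_mul_eq₀ hn, remCoeff_eq_zero (show 0 < n + 1 by omega)]
      have hA := denVal_rec hω y n
      have hB := numVal_rec hω y n
      push_cast
      linear_combination θ * hA - y * hB

/-- The Casoratian of the numerators and denominators does not vanish, because `ω` is not an
integer. -/
theorem casoratian_ne_zero [CharZero F] (hω : ω ∉ Set.range ((↑) : ℤ → ℚ)) (y : F) (n : ℕ) :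
    denVal ω y n * numVal ω y (n + 1) - denVal ω y (n + 1) * numVal ω y n ≠ 0 := by
  induction n with
  | zero => simp [denVal_zero, numVal_one hω, numVal_zero]
  | succ n ih =>
    have hA := denVal_rec hω y n
    have hB := numVal_rec hω y n
    have e : ((n : F) + 1) * (n + 2) * (2 * n + 1) *
        (denVal ω y (n + 1) * numVal ω y (n + 2) - denVal ω y (n + 2) * numVal ω y (n + 1)) =
        (n - ω) * (n + 1 + ω) * (2 * n + 3) *
          (denVal ω y n * numVal ω y (n + 1) - denVal ω y (n + 1) * numVal ω y n) := by
      linear_combination denVal ω y (n + 1) * hB - numVal ω y (n + 1) * hA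
    intro h0
    rw [show n + 1 + 1 = n + 2 from rfl] at h0
    rw [h0, mul_zero] at e
    have h1 : ((n : F) - ω) ≠ 0 := by
      have := sub_intCast_ne_zero hω n
      rw [← neg_ne_zero, neg_sub]
      exact_mod_cast this
    have h2 : (n + 1 + ω : F) ≠ 0 := by
      have := sub_intCast_ne_zero hω (-(n : ℤ) - 1)
      have h' : (n + 1 + ω : ℚ) ≠ 0 := fun h => this (by push_cast; linarith)
      exact_mod_cast h'
    have h3 : (2 * n + 3 : F) ≠ 0 := by
      have : ((2 * n + 3 : ℕ) : F) ≠ 0 := Nat.cast_ne_zero.2 (by omega)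
      exact_mod_cast this
    exact mul_ne_zero (mul_ne_zero (mul_ne_zero h1 h2) h3) ih e.symm

end Approximants

/-! ### Denominators of binomial coefficients -/

theorem choose_mul_factorial (x : ℚ) (i : ℕ) :
    Ring.choose x i * (i.factorial : ℚ) = ∏ j ∈ Finset.range i, (x - j) := by
  induction i with
  | zero => simp
  | succ i ih =>
    rw [Finset.prod_range_succ, ← ih, Nat.factorial_succ]
    push_cast
    linear_combination (i.factorial : ℚ) * choose_succ_mul x i

theorem exists_int_eq_of_forall_padic_norm_le_one (q : ℚ)
    (h : ∀ p : ℕ, ∀ _ : Fact p.Prime, ‖(q : ℚ_[p])‖ ≤ 1) : ∃ m : ℤ, q = m := by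
  refine ⟨q.num, ?_⟩
  suffices hd : q.den = 1 by
    conv_lhs => rw [← Rat.num_div_den q, hd]
    simp
  by_contra hd
  obtain ⟨p, hp, hpd⟩ := Nat.exists_prime_and_dvd hd
  have : Fact p.Prime := ⟨hp⟩
  have e : (q : ℚ_[p]) * (q.den : ℚ_[p]) = (q.num : ℚ_[p]) := by
    have := congrArg (Rat.cast (K := ℚ_[p])) (Rat.mul_den_eq_num q)
    push_cast at this
    exact this
  have hn : ‖(q.num : ℚ_[p])‖ < 1 := by
    rw [← e, norm_mul]
    have h1 : ‖(q.den : ℚ_[p])‖ < 1 := by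
      exact Padic.norm_natCast_lt_one_iff.2 hpd
    calc _ ≤ 1 * ‖(q.den : ℚ_[p])‖ := by gcongr; exact h p this
      _ < 1 := by rwa [one_mul]
  rw [Padic.norm_intCast_lt_one_iff] at hn
  have := q.reduced
  have h2 : p ∣ q.num.natAbs := Int.natCast_dvd.1 hn
  exact hp.one_lt.ne' (Nat.dvd_one.1 (this ▸ Nat.dvd_gcd h2 hpd))

/-- `ν_n(x) * binom(x, i)` is an integer for `i ≤ n`. -/
theorem exists_int_nuN_mul_choose (x : ℚ) {n i : ℕ} (hi : i ≤ n) :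
    ∃ m : ℤ, (nuN n x : ℚ) * Ring.choose x i = m := by
  refine exists_int_eq_of_forall_padic_norm_le_one _ fun p hp => ?_
  rw [Rat.cast_mul, norm_mul, Rat.cast_natCast]
  have hnat : ∀ k : ℕ, ‖(k : ℚ_[p])‖ ≤ 1 := fun k => by
    exact_mod_cast Padic.norm_int_le_one (p := p) k
  by_cases hpd : p ∣ x.den
  · -- clearing denominators, `x.den ^ i * i! * binom(x, i)` is an integer
    have hint : ((x.den : ℚ) ^ i * (i.factorial : ℚ)) * Ring.choose x i =
        ((∏ j ∈ Finset.range i, (x.num - x.den * j) : ℤ) : ℚ) := by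
      rw [mul_assoc, mul_comm (i.factorial : ℚ), choose_mul_factorial]
      push_cast
      rw [← Finset.card_range i, ← Finset.prod_const, Finset.card_range, ← Finset.prod_mul_distrib]
      refine Finset.prod_congr rfl fun j _ => ?_
      rw [mul_sub, mul_comm (x.den : ℚ) x, Rat.mul_den_eq_num]
    have hnorm : ‖(x.den : ℚ_[p])‖ ^ i * ‖(i.factorial : ℚ_[p])‖ *
        ‖((Ring.choose x i : ℚ) : ℚ_[p])‖ ≤ 1 := by
      have := congrArg (fun q : ℚ => ‖(q : ℚ_[p])‖) hint
      simp only [Rat.cast_mul, Rat.cast_pow, Rat.cast_natCast, Rat.cast_intCast, norm_mul,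
        norm_pow] at this
      rw [this]
      exact Padic.norm_int_le_one _
    obtain ⟨v, u, hu, hv⟩ := Nat.exists_eq_pow_mul_and_not_dvd i.factorial_ne_zero p hp.1.ne_one
    -- Legendre's formula
    have hvn : v ≤ n / (p - 1) := by
      rw [Nat.le_div_iff_mul_le (Nat.sub_pos_of_lt hp.1.one_lt)]
      have h1 : v ≤ padicValNat p i.factorial :=
        (padicValNat_dvd_iff_le i.factorial_ne_zero).1 (hv ▸ dvd_mul_right _ _)
      have h2 := sub_one_mul_padicValNat_factorial (p := p) i
      calc v * (p - 1) ≤ padicValNat p i.factorial * (p - 1) := Nat.mul_le_mul_right _ h1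
        _ = i - (p.digits i).sum := by rw [mul_comm, h2]
        _ ≤ n := (Nat.sub_le _ _).trans hi
    have hfac : ‖(p : ℚ_[p])‖ ^ (n / (p - 1)) ≤ ‖(i.factorial : ℚ_[p])‖ := by
      have hu1 : ‖(u : ℚ_[p])‖ = 1 := by
        refine le_antisymm (hnat u) (not_lt.1 fun h => hu ?_)
        exact Padic.norm_natCast_lt_one_iff.1 h
      rw [hv, Nat.cast_mul, Nat.cast_pow, norm_mul, norm_pow, hu1, mul_one]
      exact pow_le_pow_of_le_one (norm_nonneg _) (hnat p) hvn
    have hnu : ‖((nuN n x : ℕ) : ℚ_[p])‖ ≤ ‖(x.den : ℚ_[p])‖ ^ i * ‖(i.factorial : ℚ_[p])‖ := by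
      have hmem : p ∈ x.den.primeFactors := Nat.mem_primeFactors.2 ⟨hp.1, hpd, x.den_nz⟩
      rw [nuN, ← Finset.mul_prod_erase _ _ hmem]
      push_cast
      rw [norm_mul, norm_mul, norm_pow, norm_pow]
      have h3 := hnat (∏ q ∈ x.den.primeFactors.erase p, q ^ (n / (q - 1)))
      push_cast at h3
      calc _ ≤ ‖(x.den : ℚ_[p])‖ ^ i * (‖(i.factorial : ℚ_[p])‖ * 1) := by
            gcongr ?_ * (?_ * ?_)
            exact pow_le_pow_of_le_one (norm_nonneg _) (hnat _) hi
        _ = _ := by rw [mul_one]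
    exact (mul_le_mul_of_nonneg_right hnu (norm_nonneg _)).trans hnorm
  · have hx : ‖(x : ℚ_[p])‖ ≤ 1 := Padic.norm_rat_le_one hpd
    obtain ⟨z, hz⟩ : ∃ z : ℤ_[p], (z : ℚ_[p]) = x := ⟨⟨(x : ℚ_[p]), hx⟩, rfl⟩
    have h1 : ((Ring.choose x i : ℚ) : ℚ_[p]) = ((Ring.choose z i : ℤ_[p]) : ℚ_[p]) := by
      have e1 := Ring.map_choose (Rat.castHom ℚ_[p]) x i
      have e2 := Ring.map_choose (PadicInt.Coe.ringHom (p := p)) z i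
      refine e1.trans (Eq.trans ?_ e2.symm)
      exact congrArg (Ring.choose · i) hz.symm
    rw [h1]
    exact mul_le_one₀ (hnat _) (norm_nonneg _) (PadicInt.norm_le_one _)

theorem nuN_congr (n : ℕ) {x y : ℚ} (h : x.den = y.den) : nuN n x = nuN n y := by
  simp only [nuN, h]

theorem exists_int_choose_intCast (m : ℤ) (k : ℕ) : ∃ j : ℤ, Ring.choose (m : ℚ) k = j :=
  ⟨Ring.choose m k, by simpa using (Ring.map_choose (Int.castRingHom ℚ) m k).symm⟩

theorem nuN_pos (n : ℕ) (ω : ℚ) : 0 < nuN n ω := by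
  refine Nat.mul_pos (pow_pos ω.den_pos _) (Finset.prod_pos fun q hq => pow_pos ?_ _)
  exact (Nat.prime_of_mem_primeFactors hq).pos

/-! ### The common divisor `G_n` and the growth of the denominators -/

/-- The set of common divisors of which `G n ω` is the supremum. -/
def commonDivisors (n : ℕ) (ω : ℚ) : Set ℕ :=
  {d : ℕ | 0 < d ∧
    (∀ k : ℕ, k ≤ n → ∃ m : ℤ,
      (nuN n ω : ℚ) * Ring.choose ((n : ℚ) + k - 1) k * Ring.choose ((n : ℚ) - ω - 1) (n - k)
        = (d : ℚ) * m) ∧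
    (∀ k : ℕ, k < n → ∃ m : ℤ,
      (nuN n ω : ℚ) * Ring.choose ((n : ℚ) + k) k * Ring.choose ((n : ℚ) + ω) (n - 1 - k)
        = (d : ℚ) * m)}

theorem one_mem_commonDivisors (n : ℕ) (ω : ℚ) : 1 ∈ commonDivisors n ω := by
  refine ⟨one_pos, fun k hk => ?_, fun k hk => ?_⟩
  · obtain ⟨a, ha⟩ := exists_int_choose_intCast ((n : ℤ) + k - 1) k
    have hden : ((n : ℚ) - ω - 1).den = ω.den := by
      have : (n : ℚ) - ω - 1 = ((n - 1 : ℤ) : ℚ) - ω := by push_cast; ring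
      rw [this, Rat.intCast_sub_den]
    obtain ⟨b, hb⟩ := exists_int_nuN_mul_choose ((n : ℚ) - ω - 1) (Nat.sub_le n k)
    rw [nuN_congr n hden] at hb
    refine ⟨a * b, ?_⟩
    push_cast at ha ⊢
    rw [← ha, ← hb]
    ring
  · obtain ⟨a, ha⟩ := exists_int_choose_intCast ((n : ℤ) + k) k
    have hden : ((n : ℚ) + ω).den = ω.den := by simp
    obtain ⟨b, hb⟩ := exists_int_nuN_mul_choose ((n : ℚ) + ω) (show n - 1 - k ≤ n by omega)
    rw [nuN_congr n hden] at hb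
    refine ⟨a * b, ?_⟩
    push_cast at ha ⊢
    rw [← ha, ← hb]
    ring

theorem le_of_mem_commonDivisors {n : ℕ} {ω : ℚ} {d : ℕ} (hd : d ∈ commonDivisors n ω) :
    d ≤ nuN n ω * 4 ^ n := by
  obtain ⟨m, hm⟩ := hd.2.1 n le_rfl
  rw [Nat.sub_self, Ring.choose_zero_right, mul_one] at hm
  rcases n with _ | n
  · simp only [Ring.choose_zero_right, mul_one] at hm
    have h : ((nuN 0 ω : ℤ)) = d * m := by exact_mod_cast hm
    simpa using Nat.le_of_dvd (nuN_pos 0 ω) (Int.natCast_dvd_natCast.1 ⟨m, h⟩)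
  · rw [show ((n + 1 : ℕ) : ℚ) + ((n + 1 : ℕ) : ℚ) - 1 = ((2 * n + 1 : ℕ) : ℚ) by push_cast; ring,
      Ring.choose_natCast] at hm
    have h : ((nuN (n + 1) ω * (2 * n + 1).choose (n + 1) : ℕ) : ℤ) = d * m := by
      exact_mod_cast hm
    have hpos : 0 < nuN (n + 1) ω * (2 * n + 1).choose (n + 1) :=
      Nat.mul_pos (nuN_pos _ _) (Nat.choose_pos (by omega))
    refine (Nat.le_of_dvd hpos (Int.natCast_dvd_natCast.1 ⟨m, h⟩)).trans
      (Nat.mul_le_mul_left _ ?_)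
    calc (2 * n + 1).choose (n + 1) ≤ 2 ^ (2 * n + 1) := Nat.choose_le_two_pow _ _
      _ ≤ 2 ^ (2 * (n + 1)) := Nat.pow_le_pow_right (by norm_num) (by omega)
      _ = 4 ^ (n + 1) := by rw [pow_mul]; norm_num

theorem G_mem (n : ℕ) (ω : ℚ) : G n ω ∈ commonDivisors n ω :=
  Nat.sSup_mem ⟨1, one_mem_commonDivisors n ω⟩ ⟨_, fun _ => le_of_mem_commonDivisors⟩

theorem G_pos (n : ℕ) (ω : ℚ) : 0 < G n ω := (G_mem n ω).1

theorem nu_pos (ω : ℚ) : 0 < nu ω := by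
  refine mul_pos (by exact_mod_cast ω.den_pos) (Finset.prod_pos fun q hq => ?_)
  have := (Nat.prime_of_mem_primeFactors hq).pos
  positivity

theorem nuN_le (n : ℕ) (ω : ℚ) : (nuN n ω : ℝ) ≤ nu ω ^ n := by
  rw [nuN, nu, mul_pow, ← Finset.prod_pow]
  push_cast
  refine mul_le_mul_of_nonneg_left (Finset.prod_le_prod (fun _ _ => by positivity)
    fun q hq => ?_) (by positivity)
  have hq' := Nat.prime_of_mem_primeFactors hq
  have h1 : (1 : ℝ) ≤ q := by exact_mod_cast hq'.one_lt.le
  rw [← Real.rpow_natCast, ← Real.rpow_natCast, ← Real.rpow_mul (by positivity)]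
  refine Real.rpow_le_rpow_of_exponent_le h1 ?_
  have := Nat.cast_div_le (α := ℝ) (m := n) (n := q - 1)
  rw [Nat.cast_sub hq'.one_lt.le, Nat.cast_one] at this
  rw [one_div_mul_eq_div]
  exact this

theorem G_rpow_bounds (ω : ℚ) {n : ℕ} (hn : n ≠ 0) :
    (4 * nu ω)⁻¹ ≤ (G n ω : ℝ) ^ (-(1 : ℝ) / n) ∧ (G n ω : ℝ) ^ (-(1 : ℝ) / n) ≤ 1 := by
  have hG : (1 : ℝ) ≤ G n ω := by exact_mod_cast G_pos n ω
  have hn' : (0 : ℝ) < n := by exact_mod_cast Nat.pos_of_ne_zero hn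
  constructor
  · have h1 : (G n ω : ℝ) ≤ (4 * nu ω) ^ n := by
      have h := le_of_mem_commonDivisors (G_mem n ω)
      calc (G n ω : ℝ) ≤ nuN n ω * 4 ^ n := by exact_mod_cast h
        _ ≤ nu ω ^ n * 4 ^ n := by gcongr; exact nuN_le n ω
        _ = _ := by rw [mul_pow, mul_comm]
    have h4 : 0 < 4 * nu ω := mul_pos (by norm_num) (nu_pos ω)
    calc (4 * nu ω)⁻¹ = ((4 * nu ω) ^ n) ^ (-(1 : ℝ) / n) := by
          rw [← Real.rpow_natCast, ← Real.rpow_mul h4.le, mul_div_cancel₀ _ hn'.ne',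
            Real.rpow_neg_one]
      _ ≤ _ := Real.rpow_le_rpow_of_nonpos (by positivity) h1
          (div_nonpos_of_nonpos_of_nonneg (by norm_num) hn'.le)
  · exact Real.rpow_le_one_of_one_le_of_nonpos hG
      (div_nonpos_of_nonpos_of_nonneg (by norm_num) hn'.le)

theorem isBoundedUnder_G_rpow (ω : ℚ) :
    IsBoundedUnder (· ≤ ·) atTop (fun n : ℕ => (G n ω : ℝ) ^ (-(1 : ℝ) / (n : ℝ))) :=
  ⟨1, eventually_map.2 ((eventually_ne_atTop 0).mono fun _ hn => (G_rpow_bounds ω hn).2)⟩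

theorem limsup_G_pos (ω : ℚ) :
    0 < limsup (fun n : ℕ => (G n ω : ℝ) ^ (-(1 : ℝ) / (n : ℝ))) atTop := by
  have h4 : 0 < (4 * nu ω)⁻¹ := inv_pos.2 (mul_pos (by norm_num) (nu_pos ω))
  refine h4.trans_le (le_limsup_of_frequently_le ?_ (isBoundedUnder_G_rpow ω))
  exact ((eventually_ne_atTop 0).mono fun _ hn => (G_rpow_bounds ω hn).1).frequently

section Denominator

variable {K : Type*} [Field K] [NumberField K]

theorem den_spec (x : K) : 1 ≤ den x ∧ IsIntegral ℤ ((den x : K) * x) := by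
  have hne : {n : ℕ | 1 ≤ n ∧ IsIntegral ℤ ((n : K) * x)}.Nonempty := by
    have halg : IsAlgebraic ℤ x :=
      (IsFractionRing.isAlgebraic_iff ℤ ℚ K).2 (Algebra.IsAlgebraic.isAlgebraic x)
    obtain ⟨y, hy, h⟩ := halg.exists_integral_multiple
    refine ⟨y.natAbs, Int.natAbs_pos.2 hy, ?_⟩
    rw [zsmul_eq_mul] at h
    rcases Int.natAbs_eq y with e | e
    · rw [e] at h
      simpa using h
    · rw [e] at h
      simpa using h.neg
  exact Nat.sInf_mem hne

theorem Delta_pos (ω : ℚ) (β : K) : 0 < Delta ω β :=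
  mul_pos (mul_pos (nu_pos ω) (by exact_mod_cast (den_spec β).1)) (limsup_G_pos ω)

/-- The common denominator `ν_n(ω) * den(β) ^ n / G_n(ω)` of the `n`-th approximant at `β`. -/
noncomputable def commonDen (ω : ℚ) (β : K) (n : ℕ) : ℚ :=
  (nuN n ω : ℚ) * (den β : ℚ) ^ n / (G n ω : ℚ)

theorem commonDen_pos (ω : ℚ) (β : K) (n : ℕ) : 0 < commonDen ω β n := by
  have h1 := nuN_pos n ω
  have h2 := G_pos n ω
  have h3 := (den_spec β).1
  unfold commonDen
  positivity

theorem commonDen_le (ω : ℚ) (β : K) {η : ℝ} (hη : 0 < η) :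
    ∀ᶠ n : ℕ in atTop,
      (commonDen ω β n : ℝ) ≤ Real.exp (n * (Real.log (Delta ω β) + η)) := by
  set L := limsup (fun n : ℕ => (G n ω : ℝ) ^ (-(1 : ℝ) / (n : ℝ))) atTop with hL
  have hLpos : 0 < L := limsup_G_pos ω
  have hlt : L < L * Real.exp η := lt_mul_of_one_lt_right hLpos (Real.one_lt_exp_iff.2 hη)
  filter_upwards [eventually_lt_of_limsup_lt hlt (isBoundedUnder_G_rpow ω),
    eventually_ne_atTop 0] with n hn hn0
  have hn' : (n : ℝ) ≠ 0 := by exact_mod_cast hn0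
  have hG : (0 : ℝ) < G n ω := by exact_mod_cast G_pos n ω
  have h1 : (G n ω : ℝ)⁻¹ ≤ (L * Real.exp η) ^ n := by
    calc (G n ω : ℝ)⁻¹ = ((G n ω : ℝ) ^ (-(1 : ℝ) / n)) ^ n := by
          rw [← Real.rpow_natCast, ← Real.rpow_mul hG.le, div_mul_cancel₀ _ hn',
            Real.rpow_neg_one]
      _ ≤ _ := by gcongr
  calc (commonDen ω β n : ℝ) = nuN n ω * (den β : ℝ) ^ n * (G n ω : ℝ)⁻¹ := by
        simp [commonDen, div_eq_mul_inv]
    _ ≤ nu ω ^ n * (den β : ℝ) ^ n * (L * Real.exp η) ^ n := by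
        have := nu_pos ω
        gcongr
        exact nuN_le n ω
    _ = (Delta ω β * Real.exp η) ^ n := by rw [Delta, ← hL]; simp only [mul_pow]; ring
    _ = _ := by
        rw [Real.exp_nat_mul, Real.exp_add, Real.exp_log (Delta_pos ω β)]

end Denominator

/-! ### Growth of solutions of three-term recurrences -/

theorem exists_le_mul_pow_of_eventually {a : ℕ → ℝ} {R : ℝ} (hR : 0 < R) (ha : ∀ n, 0 ≤ a n)
    (h : ∀ᶠ n in atTop, a (n + 1) ≤ R * a n) : ∃ C, 0 < C ∧ ∀ n, a n ≤ C * R ^ n := by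
  obtain ⟨N, hN⟩ := eventually_atTop.1 h
  set C := ∑ i ∈ Finset.range (N + 1), a i / R ^ i with hC
  have hterm : ∀ i ∈ Finset.range (N + 1), 0 ≤ a i / R ^ i := fun i _ =>
    div_nonneg (ha i) (pow_nonneg hR.le i)
  have hCn : ∀ n, a n ≤ C * R ^ n := by
    intro n
    rcases le_or_gt n N with hn | hn
    · rw [← div_le_iff₀ (pow_pos hR n)]
      exact Finset.single_le_sum hterm (Finset.mem_range.2 (by omega))
    · induction n, hn.le using Nat.le_induction with
      | base =>
        rw [← div_le_iff₀ (pow_pos hR N)]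
        exact Finset.single_le_sum hterm (Finset.mem_range.2 (by omega))
      | succ n hn' ih =>
        have ih' : a n ≤ C * R ^ n := by
          rcases hn'.eq_or_lt with rfl | h'
          · rw [← div_le_iff₀ (pow_pos hR N)]
            exact Finset.single_le_sum hterm (Finset.mem_range.2 (by omega))
          · exact ih h'
        calc a (n + 1) ≤ R * a n := hN n hn'
          _ ≤ R * (C * R ^ n) := by gcongr
          _ = C * R ^ (n + 1) := by ring
  refine ⟨C + 1, add_pos_of_nonneg_of_pos (Finset.sum_nonneg hterm) one_pos, fun n => ?_⟩
  exact (hCn n).trans (by gcongr; linarith)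

theorem exists_le_mul_pow_of_eventually_le {a : ℕ → ℝ} {C R : ℝ} (hC : 0 < C) (hR : 0 < R)
    (ha : ∀ n, 0 ≤ a n) (h : ∀ᶠ n in atTop, a n ≤ C * R ^ n) :
    ∃ C, 0 < C ∧ ∀ n, a n ≤ C * R ^ n := by
  obtain ⟨M, hM⟩ := eventually_atTop.1 h
  have hsum : ∀ i ∈ Finset.range M, 0 ≤ a i / R ^ i := fun i _ =>
    div_nonneg (ha i) (pow_nonneg hR.le i)
  refine ⟨C + ∑ i ∈ Finset.range M, a i / R ^ i,
    add_pos_of_pos_of_nonneg hC (Finset.sum_nonneg hsum), fun n => ?_⟩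
  rw [← div_le_iff₀ (pow_pos hR n)]
  rcases le_or_gt M n with hn | hn
  · exact ((div_le_iff₀ (pow_pos hR n)).2 (hM n hn)).trans
      (le_add_of_nonneg_right (Finset.sum_nonneg hsum))
  · exact (Finset.single_le_sum hsum (Finset.mem_range.2 hn)).trans
      (le_add_of_nonneg_left hC.le)

section Perron

variable {u s t : ℕ → ℂ} {l₁ l₂ : ℂ}

/-- Solutions of a three-term recurrence with convergent coefficients grow at most at the rate of
the largest root of the limiting characteristic polynomial. -/
theorem exists_norm_le_mul_pow_of_recurrence
    (hu : ∀ n, u (n + 2) = s n * u (n + 1) - t n * u n)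
    (hs : Tendsto s atTop (𝓝 (l₁ + l₂))) (ht : Tendsto t atTop (𝓝 (l₁ * l₂)))
    {R : ℝ} (h₁ : ‖l₁‖ < R) (h₂ : ‖l₂‖ < R) : ∃ C, 0 < C ∧ ∀ n, ‖u n‖ ≤ C * R ^ n := by
  set ρ := max ‖l₁‖ ‖l₂‖ with hρ
  have hρR : ρ < R := max_lt h₁ h₂
  have hρ0 : 0 ≤ ρ := (norm_nonneg l₁).trans (le_max_left _ _)
  have hR : 0 < R := hρ0.trans_lt hρR
  obtain ⟨η, hη0, hη⟩ : ∃ η : ℝ, 0 < η ∧ ρ + 2 * η ≤ R :=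
    ⟨(R - ρ) / 2, by linarith, by linarith⟩
  obtain ⟨ε, hε0, hε1, hε2⟩ : ∃ ε : ℝ, 0 < ε ∧ ε ≤ η ∧ ε * (ρ + 1) ≤ η * η := by
    refine ⟨min η (η * η / (ρ + 1)), by positivity, min_le_left _ _, ?_⟩
    rw [← le_div_iff₀ (by positivity)]
    exact min_le_right _ _
  -- the norm `‖u (n + 1) - l₂ * u n‖ + η * ‖u n‖` is adapted to the limiting companion matrix
  have hstep : ∀ᶠ n in atTop, ‖u (n + 1 + 1) - l₂ * u (n + 1)‖ + η * ‖u (n + 1)‖ ≤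
      R * (‖u (n + 1) - l₂ * u n‖ + η * ‖u n‖) := by
    filter_upwards [Metric.tendsto_nhds.1 hs ε hε0, Metric.tendsto_nhds.1 ht ε hε0] with n hsn htn
    rw [dist_eq_norm] at hsn htn
    set v := u (n + 1) - l₂ * u n with hv
    have hu1 : u (n + 1) = v + l₂ * u n := by rw [hv]; ring
    have e1 : u (n + 1 + 1) - l₂ * u (n + 1) =
        l₁ * v + ((s n - (l₁ + l₂)) * u (n + 1) - (t n - l₁ * l₂) * u n) := by
      rw [hu n, hv]; ring
    have b1 : ‖u (n + 1)‖ ≤ ‖v‖ + ρ * ‖u n‖ := by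
      rw [hu1]
      refine (norm_add_le _ _).trans ?_
      rw [norm_mul]
      gcongr
      exact le_max_right _ _
    have b2 : ‖u (n + 1 + 1) - l₂ * u (n + 1)‖ ≤ ρ * ‖v‖ + (ε * ‖u (n + 1)‖ + ε * ‖u n‖) := by
      rw [e1]
      refine (norm_add_le _ _).trans (add_le_add ?_ ((norm_sub_le _ _).trans ?_))
      · rw [norm_mul]
        gcongr
        exact le_max_left _ _
      · rw [norm_mul, norm_mul]
        gcongr
    calc _ ≤ ρ * ‖v‖ + (ε * (‖v‖ + ρ * ‖u n‖) + ε * ‖u n‖) + η * (‖v‖ + ρ * ‖u n‖) := by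
          refine add_le_add (b2.trans ?_) (by gcongr)
          gcongr
      _ = (ρ + ε + η) * ‖v‖ + (ε * (ρ + 1) + η * ρ) * ‖u n‖ := by ring
      _ ≤ R * ‖v‖ + (R * η) * ‖u n‖ := by
          gcongr
          · linarith
          · nlinarith
      _ = _ := by ring
  obtain ⟨C, hC, h⟩ := exists_le_mul_pow_of_eventually hR
    (a := fun n => ‖u (n + 1) - l₂ * u n‖ + η * ‖u n‖) (fun n => by positivity) hstep
  refine ⟨C / η, by positivity, fun n => ?_⟩
  rw [div_mul_eq_mul_div, le_div_iff₀ hη0, mul_comm]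
  exact (le_add_of_nonneg_left (norm_nonneg _)).trans (h n)

/-- In a small perturbation of the diagonal system with `‖l₁‖ < 1 < ‖l₂‖`, if the component along
`l₂` is bounded then it is dominated by the component along `l₁`, which decays: if it ever
dominated, it would keep doing so and grow without bound. -/
theorem exists_norm_le_mul_pow_of_perturbation {x y : ℕ → ℂ} {δ R B : ℝ} (hδ0 : 0 < δ)
    (hδ1 : ‖l₁‖ + δ ≤ min R 1) (hδ2 : 1 + δ ≤ ‖l₂‖) (hB : ∀ n, ‖x n‖ ≤ B)
    (hstep : ∀ᶠ n in atTop,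
      ‖x (n + 1) - l₂ * x n‖ ≤ δ / 4 * (‖x n‖ + ‖y n‖) ∧
      ‖y (n + 1) - l₁ * y n‖ ≤ δ / 4 * (‖x n‖ + ‖y n‖)) :
    ∃ C, 0 < C ∧ ∀ᶠ n in atTop, ‖x n‖ + ‖y n‖ ≤ C * R ^ n := by
  have hl1 := norm_nonneg l₁
  have h₁ : ‖l₁‖ ≤ 1 := by linarith [min_le_right R 1]
  have hR0 : 0 < R := by linarith [min_le_left R 1]
  obtain ⟨N, hN⟩ := eventually_atTop.1 hstep
  have hxlow : ∀ n, N ≤ n → ‖y n‖ ≤ ‖x n‖ →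
      (1 + δ / 2) * ‖x n‖ ≤ ‖x (n + 1)‖ ∧ ‖y (n + 1)‖ ≤ ‖x (n + 1)‖ := by
    intro n hn hyx
    obtain ⟨b1, b2⟩ := hN n hn
    have c1 : ‖l₂ * x n‖ ≤ ‖x (n + 1)‖ + ‖x (n + 1) - l₂ * x n‖ := by
      have := norm_sub_le (x (n + 1)) (x (n + 1) - l₂ * x n)
      rwa [sub_sub_cancel] at this
    have c2 : ‖y (n + 1)‖ ≤ ‖l₁ * y n‖ + ‖y (n + 1) - l₁ * y n‖ := by
      have := norm_add_le (l₁ * y n) (y (n + 1) - l₁ * y n)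
      rwa [add_sub_cancel] at this
    rw [norm_mul] at c1 c2
    have d1 : (1 + δ) * ‖x n‖ ≤ ‖l₂‖ * ‖x n‖ := by gcongr
    have d2 : ‖l₁‖ * ‖y n‖ ≤ 1 * ‖x n‖ := by gcongr
    constructor <;> nlinarith
  have hsmall : ∀ n, N ≤ n → ‖x n‖ ≤ ‖y n‖ := by
    intro n hn
    by_contra! hlt
    have hgrow : ∀ k, (1 + δ / 2) ^ k * ‖x n‖ ≤ ‖x (n + k)‖ ∧ ‖y (n + k)‖ ≤ ‖x (n + k)‖ := by
      intro k
      induction k with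
      | zero => simpa using hlt.le
      | succ k ih =>
        obtain ⟨g1, g2⟩ := hxlow (n + k) (by omega) ih.2
        refine ⟨?_, g2⟩
        calc (1 + δ / 2) ^ (k + 1) * ‖x n‖ = (1 + δ / 2) * ((1 + δ / 2) ^ k * ‖x n‖) := by ring
          _ ≤ (1 + δ / 2) * ‖x (n + k)‖ := by gcongr; exact ih.1
          _ ≤ _ := g1
    have hxpos : 0 < ‖x n‖ := (norm_nonneg _).trans_lt hlt
    obtain ⟨k, hk⟩ := pow_unbounded_of_one_lt (B / ‖x n‖)
      (show 1 < 1 + δ / 2 by linarith)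
    rw [div_lt_iff₀ hxpos] at hk
    linarith [(hgrow k).1, hB (n + k)]
  have hydec : ∀ᶠ n in atTop, ‖y (n + 1)‖ ≤ R * ‖y n‖ := by
    filter_upwards [eventually_ge_atTop N] with n hn
    have b2 := (hN n hn).2
    have hxy := hsmall n hn
    have c2 : ‖y (n + 1)‖ ≤ ‖l₁ * y n‖ + ‖y (n + 1) - l₁ * y n‖ := by
      have := norm_add_le (l₁ * y n) (y (n + 1) - l₁ * y n)
      rwa [add_sub_cancel] at this
    rw [norm_mul] at c2
    have hyn := norm_nonneg (y n)
    have d1 : (‖l₁‖ + δ) * ‖y n‖ ≤ R * ‖y n‖ := by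
      gcongr
      exact hδ1.trans (min_le_left _ _)
    nlinarith
  obtain ⟨C, hC, h⟩ := exists_le_mul_pow_of_eventually hR0 (fun n => norm_nonneg (y n)) hydec
  refine ⟨2 * C, by positivity, ?_⟩
  filter_upwards [eventually_ge_atTop N] with n hn
  linarith [hsmall n hn, h n]

/-- A bounded solution of a three-term recurrence whose limiting characteristic polynomial has
roots `‖l₁‖ < 1 < ‖l₂‖` decays at the rate of the smaller root. -/
theorem exists_norm_le_mul_pow_of_bounded
    (hu : ∀ n, u (n + 2) = s n * u (n + 1) - t n * u n)
    (hs : Tendsto s atTop (𝓝 (l₁ + l₂))) (ht : Tendsto t atTop (𝓝 (l₁ * l₂)))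
    (h₁ : ‖l₁‖ < 1) (h₂ : 1 < ‖l₂‖) {B : ℝ} (hB : ∀ n, ‖u n‖ ≤ B)
    {R : ℝ} (hR : ‖l₁‖ < R) : ∃ C, 0 < C ∧ ∀ n, ‖u n‖ ≤ C * R ^ n := by
  have hR0 : 0 < R := (norm_nonneg _).trans_lt hR
  have hl : l₂ - l₁ ≠ 0 := fun h => by rw [sub_eq_zero.1 h] at h₂; linarith
  set x : ℕ → ℂ := fun n => u (n + 1) - l₁ * u n with hx
  set y : ℕ → ℂ := fun n => u (n + 1) - l₂ * u n with hy
  have hun : ∀ n, u n = (x n - y n) / (l₂ - l₁) := fun n => by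
    rw [eq_div_iff hl, hx, hy]; ring
  have hun1 : ∀ n, u (n + 1) = (l₂ * x n - l₁ * y n) / (l₂ - l₁) := fun n => by
    rw [eq_div_iff hl, hx, hy]; ring
  obtain ⟨δ, hδ0, hδ1, hδ2⟩ : ∃ δ : ℝ, 0 < δ ∧ ‖l₁‖ + δ ≤ min R 1 ∧ 1 + δ ≤ ‖l₂‖ := by
    refine ⟨min (min R 1 - ‖l₁‖) (‖l₂‖ - 1), lt_min (sub_pos.2 (lt_min hR h₁)) (sub_pos.2 h₂),
      ?_, ?_⟩
    · linarith [min_le_left (min R 1 - ‖l₁‖) (‖l₂‖ - 1)]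
    · linarith [min_le_right (min R 1 - ‖l₁‖) (‖l₂‖ - 1)]
  -- the perturbation at each step is at most `δ / 4 * (‖x n‖ + ‖y n‖)`
  set κ := (‖l₁‖ + ‖l₂‖ + 2) / ‖l₂ - l₁‖ with hκ
  have hκ0 : 0 < κ := by positivity
  set ε := δ / (4 * κ) with hε
  have hε0 : 0 < ε := by positivity
  have hstep : ∀ᶠ n in atTop,
      ‖x (n + 1) - l₂ * x n‖ ≤ δ / 4 * (‖x n‖ + ‖y n‖) ∧
      ‖y (n + 1) - l₁ * y n‖ ≤ δ / 4 * (‖x n‖ + ‖y n‖) := by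
    filter_upwards [Metric.tendsto_nhds.1 hs ε hε0, Metric.tendsto_nhds.1 ht ε hε0] with n hsn htn
    rw [dist_eq_norm] at hsn htn
    have e1 : x (n + 1) - l₂ * x n =
        (s n - (l₁ + l₂)) * u (n + 1) - (t n - l₁ * l₂) * u n := by
      simp only [hx]; rw [hu n]; ring
    have e2 : y (n + 1) - l₁ * y n =
        (s n - (l₁ + l₂)) * u (n + 1) - (t n - l₁ * l₂) * u n := by
      simp only [hy]; rw [hu n]; ring
    have hxn := norm_nonneg (x n)
    have hyn := norm_nonneg (y n)
    have b0 : ‖u n‖ ≤ (‖x n‖ + ‖y n‖) / ‖l₂ - l₁‖ := by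
      rw [hun n, norm_div]
      gcongr
      exact norm_sub_le _ _
    have b1 : ‖u (n + 1)‖ ≤ (‖l₁‖ + ‖l₂‖ + 1) * (‖x n‖ + ‖y n‖) / ‖l₂ - l₁‖ := by
      rw [hun1 n, norm_div]
      gcongr
      refine (norm_sub_le _ _).trans ?_
      rw [norm_mul, norm_mul]
      nlinarith [norm_nonneg l₁, norm_nonneg l₂]
    have b : ‖(s n - (l₁ + l₂)) * u (n + 1) - (t n - l₁ * l₂) * u n‖ ≤
        δ / 4 * (‖x n‖ + ‖y n‖) := by
      refine (norm_sub_le _ _).trans ?_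
      rw [norm_mul, norm_mul]
      calc _ ≤ ε * ((‖l₁‖ + ‖l₂‖ + 1) * (‖x n‖ + ‖y n‖) / ‖l₂ - l₁‖) +
            ε * ((‖x n‖ + ‖y n‖) / ‖l₂ - l₁‖) := by gcongr
        _ = ε * κ * (‖x n‖ + ‖y n‖) := by rw [hκ]; ring
        _ = _ := by rw [hε]; field_simp
    exact ⟨e1 ▸ b, e2 ▸ b⟩
  have hxB : ∀ m, ‖x m‖ ≤ B + ‖l₁‖ * B := fun m => by
    refine (norm_sub_le _ _).trans ?_
    rw [norm_mul]
    gcongr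
    · exact hB _
    · exact hB _
  obtain ⟨C, hC, h⟩ := exists_norm_le_mul_pow_of_perturbation hδ0 hδ1 hδ2 hxB hstep
  refine exists_le_mul_pow_of_eventually_le (C := C / ‖l₂ - l₁‖) (by positivity) hR0
    (fun n => norm_nonneg (u n)) (h.mono fun n hn => ?_)
  rw [hun n, norm_div, div_mul_eq_mul_div]
  gcongr
  exact (norm_sub_le _ _).trans hn

end Perron

/-! ### Archimedean estimates for the approximants -/

theorem rootPlus_add_rootMinus (z : ℂ) : rootPlus 1 z + rootMinus 1 z = 2 * (2 * z - 1) := by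
  rw [rootPlus, rootMinus]; ring

theorem rootPlus_mul_rootMinus (z : ℂ) : rootPlus 1 z * rootMinus 1 z = 1 := by
  have h : ((z ^ 2 - z * 1) ^ (1 / 2 : ℂ)) ^ 2 = z ^ 2 - z * 1 := by
    have h2 := Complex.cpow_nat_inv_pow (z ^ 2 - z * 1) (n := 2) two_ne_zero
    rwa [show ((2 : ℕ) : ℂ)⁻¹ = 1 / 2 by norm_num] at h2
  rw [rootPlus, rootMinus]
  linear_combination (-4) * h

/-- The roots of the limiting characteristic polynomial of the recurrence at `y = -z`. -/
theorem exists_roots (z : ℂ) : ∃ l₁ l₂ : ℂ, l₁ + l₂ = 2 * (1 + 2 * (-z)) ∧ l₁ * l₂ = 1 ∧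
    ‖l₁‖ = rho₁ 1 z ∧ ‖l₂‖ = rho₂ 1 z := by
  have h1 := rootPlus_add_rootMinus z
  have h2 := rootPlus_mul_rootMinus z
  rcases le_total ‖rootPlus 1 z‖ ‖rootMinus 1 z‖ with h | h
  · exact ⟨-rootPlus 1 z, -rootMinus 1 z, by linear_combination -h1, by linear_combination h2,
      by rw [norm_neg, rho₁, min_eq_left h], by rw [norm_neg, rho₂, max_eq_right h]⟩
  · exact ⟨-rootMinus 1 z, -rootPlus 1 z, by linear_combination -h1, by linear_combination h2,
      by rw [norm_neg, rho₁, min_eq_right h], by rw [norm_neg, rho₂, max_eq_left h]⟩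

theorem rho₁_mul_rho₂ (z : ℂ) : rho₁ 1 z * rho₂ 1 z = 1 := by
  rw [rho₁, rho₂, min_mul_max, ← norm_mul, rootPlus_mul_rootMinus, norm_one]

theorem rho₂_pos (z : ℂ) : 0 < rho₂ 1 z := by
  have h := rho₁_mul_rho₂ z
  have h0 : 0 ≤ rho₂ 1 z := (norm_nonneg _).trans (le_max_left _ _)
  refine h0.lt_of_ne fun h' => ?_
  rw [← h', mul_zero] at h
  exact zero_ne_one h

theorem rho₁_pos (z : ℂ) : 0 < rho₁ 1 z := by
  have h := rho₁_mul_rho₂ z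
  exact pos_of_mul_pos_left (h ▸ one_pos) (rho₂_pos z).le

theorem rho₁_lt_one {z : ℂ} (hz : 1 < ‖z‖) : rho₁ 1 z < 1 := by
  obtain ⟨l₁, l₂, hs, hp, h₁, h₂⟩ := exists_roots z
  have hle : rho₁ 1 z ≤ rho₂ 1 z := min_le_max
  have hpr := rho₁_mul_rho₂ z
  by_contra! hge
  have he : rho₁ 1 z = 1 := le_antisymm (by nlinarith) hge
  rw [he] at h₁
  -- if `‖l₁‖ = 1` then `l₂` is the conjugate of `l₁`, so that `z` lies in the interval `[0, 1]`
  have hconj : l₂ = (starRingEnd ℂ) l₁ := by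
    have h0 : l₁ ≠ 0 := by rw [← norm_pos_iff, h₁]; exact one_pos
    apply mul_left_cancel₀ h0
    rw [hp, Complex.mul_conj, Complex.normSq_eq_norm_sq, h₁]
    simp
  have hz' : z = (((1 - l₁.re) / 2 : ℝ) : ℂ) := by
    rw [hconj, Complex.add_conj] at hs
    push_cast at hs ⊢
    linear_combination (1 / 4 : ℂ) * hs
  have hre := abs_le.1 ((Complex.abs_re_le_norm l₁).trans h₁.le)
  rw [hz', Complex.norm_real, Real.norm_eq_abs] at hz
  have : |(1 - l₁.re) / 2| ≤ 1 := abs_le.2 ⟨by linarith, by linarith⟩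
  linarith

theorem one_lt_rho₂ {z : ℂ} (hz : 1 < ‖z‖) : 1 < rho₂ 1 z := by
  have h1 := rho₁_lt_one hz
  have h2 := rho₁_mul_rho₂ z
  have h3 := rho₂_pos z
  nlinarith

/-- The recurrence, normalized so that its coefficients converge. -/
theorem JacobiRec.exists_tendsto {ω : ℚ} {y : ℂ} {u : ℕ → ℂ} (hu : JacobiRec ω y u) :
    ∃ s t : ℕ → ℂ, (∀ n, u (n + 2) = s n * u (n + 1) - t n * u n) ∧
      Tendsto s atTop (𝓝 (2 * (1 + 2 * y))) ∧ Tendsto t atTop (𝓝 1) := by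
  have ne1 : ∀ n : ℕ, ((n : ℂ) + 1) ≠ 0 := fun n => by exact_mod_cast (n.succ_ne_zero)
  have ne2 : ∀ n : ℕ, ((n : ℂ) + 2) ≠ 0 := fun n => by exact_mod_cast ((n + 1).succ_ne_zero)
  have ne3 : ∀ n : ℕ, (2 * (n : ℂ) + 1) ≠ 0 := fun n => by
    exact_mod_cast ((2 * n).succ_ne_zero)
  refine ⟨fun n => (3 + 2 * n) / (2 + 1 * n) * (1 + 2 * y) +
      (2 * ω + 1) * ((1 + 0 * n) / (2 + 1 * n) * ((1 + 0 * n) / (1 + 2 * n))),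
    fun n => (-ω + 1 * n) / (1 + 1 * n) * ((1 + ω + 1 * n) / (2 + 1 * n)) *
      ((3 + 2 * n) / (1 + 2 * n)), fun n => ?_, ?_, ?_⟩
  · have h := hu n
    have n1 := ne1 n
    have n2 := ne2 n
    have n3 := ne3 n
    have n4 : (1 + (n : ℂ)) ≠ 0 := by rwa [add_comm]
    have n5 : (2 + (n : ℂ)) ≠ 0 := by rwa [add_comm]
    have n6 : (1 + 2 * (n : ℂ)) ≠ 0 := by rwa [add_comm]
    simp only [one_mul, zero_mul, add_zero]
    field_simp
    linear_combination h
  · have h := ((tendsto_add_mul_div_add_mul_atTop_nhds (𝕜 := ℂ) 3 2 2 one_ne_zero).mul_const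
      (1 + 2 * y)).add (((tendsto_add_mul_div_add_mul_atTop_nhds (𝕜 := ℂ) 1 2 0 one_ne_zero).mul
        (tendsto_add_mul_div_add_mul_atTop_nhds (𝕜 := ℂ) 1 1 0 two_ne_zero)).const_mul
          (2 * (ω : ℂ) + 1))
    convert h using 2
    ring
  · have h := ((tendsto_add_mul_div_add_mul_atTop_nhds (𝕜 := ℂ) (-ω) 1 1 one_ne_zero).mul
      (tendsto_add_mul_div_add_mul_atTop_nhds (𝕜 := ℂ) (1 + ω) 2 1 one_ne_zero)).mul
        (tendsto_add_mul_div_add_mul_atTop_nhds (𝕜 := ℂ) 3 1 2 two_ne_zero)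
    convert h using 2
    norm_num

theorem JacobiRec.exists_norm_le_of_rho₂_lt {ω : ℚ} {z : ℂ} {u : ℕ → ℂ}
    (hu : JacobiRec ω (-z) u) {R : ℝ} (hR : rho₂ 1 z < R) :
    ∃ C, 0 < C ∧ ∀ n, ‖u n‖ ≤ C * R ^ n := by
  obtain ⟨s, t, hr, hs, ht⟩ := hu.exists_tendsto
  obtain ⟨l₁, l₂, h1, h2, h3, h4⟩ := exists_roots z
  rw [← h1] at hs
  rw [← h2] at ht
  refine exists_norm_le_mul_pow_of_recurrence hr hs ht ?_ (h4 ▸ hR)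
  exact h3 ▸ (min_le_max : rho₁ 1 z ≤ rho₂ 1 z).trans_lt hR

theorem JacobiRec.exists_norm_le_of_rho₁_lt {ω : ℚ} {z : ℂ} (hz : 1 < ‖z‖) {u : ℕ → ℂ}
    (hu : JacobiRec ω (-z) u) {B : ℝ} (hB : ∀ n, ‖u n‖ ≤ B) {R : ℝ} (hR : rho₁ 1 z < R) :
    ∃ C, 0 < C ∧ ∀ n, ‖u n‖ ≤ C * R ^ n := by
  obtain ⟨s, t, hr, hs, ht⟩ := hu.exists_tendsto
  obtain ⟨l₁, l₂, h1, h2, h3, h4⟩ := exists_roots z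
  rw [← h1] at hs
  rw [← h2] at ht
  exact exists_norm_le_mul_pow_of_bounded hr hs ht (h3 ▸ rho₁_lt_one hz) (h4 ▸ one_lt_rho₂ hz)
    hB (h3 ▸ hR)

theorem exists_abs_choose_le (ω : ℚ) {a : ℝ} (ha : 1 < a) :
    ∃ C, 0 < C ∧ ∀ n : ℕ, |((Ring.choose ω n : ℚ) : ℝ)| ≤ C * a ^ n := by
  refine exists_le_mul_pow_of_eventually (one_pos.trans ha) (fun n => abs_nonneg _) ?_
  filter_upwards [eventually_ge_atTop ⌈|(ω : ℝ)| / (a - 1)⌉₊] with n hn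
  have hn' : |(ω : ℝ)| ≤ n * (a - 1) := by
    rw [← div_le_iff₀ (by linarith)]
    exact (Nat.le_ceil _).trans (by exact_mod_cast hn)
  rw [choose_succ_eq]
  push_cast
  rw [abs_div, abs_mul, abs_of_pos (show (0 : ℝ) < n + 1 by positivity),
    div_le_iff₀ (by positivity)]
  have h1 : |(ω : ℝ) - n| ≤ a * (n + 1) := by
    refine (abs_sub _ _).trans ?_
    rw [abs_of_nonneg (Nat.cast_nonneg (α := ℝ) n)]
    nlinarith
  calc _ ≤ a * (n + 1) * |((Ring.choose ω n : ℚ) : ℝ)| := by gcongr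
    _ = _ := by ring

theorem exists_abs_add_choose_le (ω : ℚ) {a : ℝ} (ha : 1 < a) :
    ∃ C, 0 < C ∧ ∀ n : ℕ, |((Ring.choose ((n : ℚ) + ω) n : ℚ) : ℝ)| ≤ C * a ^ n := by
  refine exists_le_mul_pow_of_eventually (one_pos.trans ha) (fun n => abs_nonneg _) ?_
  filter_upwards [eventually_ge_atTop ⌈|(ω : ℝ)| / (a - 1)⌉₊] with n hn
  have hn' : |(ω : ℝ)| ≤ n * (a - 1) := by
    rw [← div_le_iff₀ (by linarith)]
    exact (Nat.le_ceil _).trans (by exact_mod_cast hn)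
  rw [add_choose_succ]
  push_cast
  rw [abs_div, abs_mul, abs_of_pos (show (0 : ℝ) < n + 1 by positivity),
    div_le_iff₀ (by positivity)]
  have h1 : |(n : ℝ) + 1 + ω| ≤ a * (n + 1) := by
    refine (abs_add_le _ _).trans ?_
    rw [abs_of_nonneg (show (0 : ℝ) ≤ n + 1 by positivity)]
    nlinarith
  calc _ ≤ |((Ring.choose ((n : ℚ) + ω) n : ℚ) : ℝ)| * (a * (n + 1)) := by gcongr
    _ = _ := by ring

/-- A bound which is uniform in the order `n` of the approximant. -/
theorem exists_abs_remCoeff_le (ω : ℚ) {a : ℝ} (ha : 1 < a) :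
    ∃ C, 0 < C ∧ ∀ n m : ℕ, |(remCoeff ω n m : ℝ)| ≤ C * (a ^ 2) ^ m := by
  obtain ⟨C₁, hC₁, h₁⟩ := exists_abs_choose_le ω ha
  obtain ⟨C₂, hC₂, h₂⟩ := exists_abs_add_choose_le ω ha
  refine ⟨C₁ * C₂, by positivity, fun n m => ?_⟩
  rcases lt_or_ge m n with h | h
  · rw [remCoeff_eq_zero h]
    simp only [Rat.cast_zero, abs_zero]
    positivity
  · have hprod : |∏ i ∈ Finset.range n, ((m : ℝ) - i) / ((m : ℝ) + 1 + i)| ≤ 1 := by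
      rw [Finset.abs_prod]
      refine Finset.prod_le_one (fun _ _ => abs_nonneg _) fun i hi => ?_
      have him : (i : ℝ) ≤ m := by exact_mod_cast (Finset.mem_range.1 hi).le.trans h
      rw [abs_of_nonneg (div_nonneg (by linarith) (by positivity))]
      exact (div_le_one (by positivity)).2 (by linarith)
    rw [remCoeff]
    push_cast
    rw [abs_mul, abs_mul, abs_mul, abs_pow, abs_neg, abs_one, one_pow, one_mul]
    calc _ ≤ C₁ * a ^ m * (C₂ * a ^ n) * 1 := by
          gcongr
          · exact h₁ m
          · exact h₂ n
      _ ≤ C₁ * a ^ m * (C₂ * a ^ m) * 1 := by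
          gcongr
          exact ha.le
      _ = _ := by rw [← pow_mul, mul_comm 2 m, pow_mul]; ring

/-- The remainder is bounded, and so decays at the rate of the smaller root. -/
theorem exists_norm_remainder_le {ω : ℚ} (hω : ω ∉ Set.range ((↑) : ℤ → ℚ)) {y θ : ℂ}
    (hy : 1 < ‖y‖) (hθ : HasSum (fun m : ℕ => ((Ring.choose ω m : ℚ) : ℂ) * y⁻¹ ^ m) θ) :
    ∃ B, ∀ n, ‖denVal ω y n * θ - y * numVal ω y n‖ ≤ B := by
  obtain ⟨b, hb1, hby⟩ := exists_between hy
  have hb0 : 0 < b := one_pos.trans hb1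
  obtain ⟨C, hC, h⟩ :=
    exists_abs_remCoeff_le ω (a := √b) (by rwa [Real.lt_sqrt one_pos.le, one_pow])
  rw [Real.sq_sqrt hb0.le] at h
  have hq : b / ‖y‖ < 1 := (div_lt_one (hb0.trans hby)).2 hby
  have hg := (hasSum_geometric_of_lt_one (div_nonneg hb0.le (norm_nonneg y)) hq).mul_left C
  have hy0 : y ≠ 0 := norm_pos_iff.1 (one_pos.trans hy)
  refine ⟨_, fun n => tsum_of_norm_bounded (f := fun m : ℕ => (remCoeff ω n m : ℂ) * y⁻¹ ^ m) hg
    (fun m => ?_) |> (le_of_eq_of_le (congrArg norm (hasSum_remainder hω hy0 hθ n).tsum_eq.symm))⟩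
  rw [norm_mul, norm_pow, norm_inv, div_pow, ← Complex.ofReal_ratCast, Complex.norm_real,
    Real.norm_eq_abs, inv_pow, div_eq_mul_inv, ← mul_assoc]
  gcongr
  exact h n m

/-! ### Places and completions -/

section Places

variable {K : Type*} [Field K] [NumberField K]

theorem Place.weight_pos (v : Place K) : 0 < v.weight := by
  have hd : (0 : ℝ) < Module.finrank ℚ K := by exact_mod_cast Module.finrank_pos
  rcases v with v | v
  · exact div_pos (by exact_mod_cast InfinitePlace.mult_pos) hd
  · exact div_pos one_pos hd

theorem sum_mult_div_finrank :
    ∑ v : InfinitePlace K, (v.mult : ℝ) / (Module.finrank ℚ K : ℝ) = 1 := by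
  have hd : (0 : ℝ) < Module.finrank ℚ K := by exact_mod_cast Module.finrank_pos
  rw [← Finset.sum_div, ← Nat.cast_sum, InfinitePlace.sum_mult_eq, div_self hd.ne']

theorem Place.weight_le_one (v : Place K) : v.weight ≤ 1 := by
  rcases v with v | v
  · rw [← sum_mult_div_finrank (K := K)]
    exact Finset.single_le_sum (f := fun v : InfinitePlace K =>
      (v.mult : ℝ) / (Module.finrank ℚ K : ℝ)) (fun _ _ => by positivity) (Finset.mem_univ v)
  · have hd : 1 ≤ Module.finrank ℚ K := Module.finrank_pos
    exact (div_le_one (by exact_mod_cast hd)).2 (by exact_mod_cast hd)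

theorem Place.nabs_nonneg (v : Place K) (x : K) : 0 ≤ v.nabs x :=
  Real.rpow_nonneg (v.abv.nonneg x) _

theorem Place.nabs_mul (v : Place K) (x y : K) : v.nabs (x * y) = v.nabs x * v.nabs y := by
  rw [nabs, map_mul, Real.mul_rpow (v.abv.nonneg x) (v.abv.nonneg y)]; rfl

theorem Place.nabs_one (v : Place K) : v.nabs 1 = 1 := by rw [nabs, map_one, Real.one_rpow]

theorem Place.nabs_zero (v : Place K) : v.nabs 0 = 0 := by
  rw [nabs, map_zero, Real.zero_rpow v.weight_pos.ne']

theorem Place.nabs_neg (v : Place K) (x : K) : v.nabs (-x) = v.nabs x := by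
  rw [nabs, AbsoluteValue.map_neg, nabs]

theorem Place.nabs_pow (v : Place K) (x : K) (n : ℕ) : v.nabs (x ^ n) = v.nabs x ^ n := by
  induction n with
  | zero => simp [v.nabs_one]
  | succ n ih => rw [pow_succ, v.nabs_mul, ih, pow_succ]

theorem Place.nabs_pos (v : Place K) {x : K} (hx : x ≠ 0) : 0 < v.nabs x :=
  Real.rpow_pos_of_pos (v.abv.pos hx) _

theorem Place.nabs_inv (v : Place K) (x : K) : v.nabs x⁻¹ = (v.nabs x)⁻¹ := by
  rw [nabs, map_inv₀, Real.inv_rpow (v.abv.nonneg x), nabs]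

theorem Place.nabs_div (v : Place K) (x y : K) : v.nabs (x / y) = v.nabs x / v.nabs y := by
  rw [div_eq_mul_inv, nabs_mul, nabs_inv, div_eq_mul_inv]

theorem Place.abv_eq (v : Place K) (x : K) : v.abv x = v.nabs x ^ (v.weight)⁻¹ := by
  rw [nabs, ← Real.rpow_mul (v.abv.nonneg x), mul_inv_cancel₀ v.weight_pos.ne', Real.rpow_one]

/-- The embedding of `K` into `K_v` as a ring homomorphism. -/
noncomputable def Place.coeHom (v : Place K) : K →+* v.abv.Completion :=
  UniformSpace.Completion.coeRingHom.comp (WithAbs.equiv v.abv).symm.toRingHom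

theorem Place.coe_eq_coeHom (v : Place K) (x : K) : v.coe x = v.coeHom x := rfl

theorem Place.norm_coeHom (v : Place K) (x : K) : ‖v.coeHom x‖ = v.abv x := by
  rw [← v.coe_eq_coeHom, coe, UniformSpace.Completion.norm_coe]; rfl

theorem Place.nabsCompletion_coeHom (v : Place K) (x : K) :
    v.nabsCompletion (v.coeHom x) = v.nabs x := by
  rw [nabsCompletion, norm_coeHom, nabs]

instance Place.charZero_completion (v : Place K) : CharZero v.abv.Completion :=
  charZero_of_injective_ringHom v.coeHom.injective

theorem Place.nabsCompletion_nonneg (v : Place K) (x : v.abv.Completion) :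
    0 ≤ v.nabsCompletion x := Real.rpow_nonneg (norm_nonneg x) _

theorem Place.nabsCompletion_mul (v : Place K) (x y : v.abv.Completion) :
    v.nabsCompletion (x * y) = v.nabsCompletion x * v.nabsCompletion y := by
  rw [nabsCompletion, norm_mul, Real.mul_rpow (norm_nonneg x) (norm_nonneg y)]; rfl

theorem Place.nabsCompletion_sub_le (v : Place K) (x y : v.abv.Completion) :
    v.nabsCompletion (x - y) ≤ 2 * max (v.nabsCompletion x) (v.nabsCompletion y) := by
  have hw := v.weight_pos.le
  have hm : 0 ≤ max ‖x‖ ‖y‖ := (norm_nonneg x).trans (le_max_left _ _)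
  have h2 : ‖x - y‖ ≤ 2 * max ‖x‖ ‖y‖ := by
    refine (norm_sub_le x y).trans ?_
    linarith [le_max_left ‖x‖ ‖y‖, le_max_right ‖x‖ ‖y‖]
  calc v.nabsCompletion (x - y) ≤ (2 * max ‖x‖ ‖y‖) ^ v.weight :=
        Real.rpow_le_rpow (norm_nonneg _) h2 hw
    _ = 2 ^ v.weight * max ‖x‖ ‖y‖ ^ v.weight := Real.mul_rpow (by norm_num) hm
    _ ≤ 2 * max ‖x‖ ‖y‖ ^ v.weight := by
        gcongr
        calc (2 : ℝ) ^ v.weight ≤ 2 ^ (1 : ℝ) :=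
              Real.rpow_le_rpow_of_exponent_le (by norm_num) v.weight_le_one
          _ = 2 := Real.rpow_one 2
    _ = _ := by
        congr 1
        simp only [nabsCompletion]
        rcases le_total ‖x‖ ‖y‖ with h | h
        · rw [max_eq_right h, max_eq_right (Real.rpow_le_rpow (norm_nonneg _) h hw)]
        · rw [max_eq_left h, max_eq_left (Real.rpow_le_rpow (norm_nonneg _) h hw)]

theorem Place.nabs_sub_le (v : Place K) (x y : K) :
    v.nabs (x - y) ≤ 2 * max (v.nabs x) (v.nabs y) := by
  simpa only [← v.nabsCompletion_coeHom, map_sub] using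
    v.nabsCompletion_sub_le (v.coeHom x) (v.coeHom y)

theorem nabs_inr_add_le (v : FinitePlace K) (x y : K) :
    Place.nabs (.inr v) (x + y) ≤ max (Place.nabs (.inr v) x) (Place.nabs (.inr v) y) := by
  have hw := (Place.weight_pos (.inr v : Place K)).le
  have h : v.1 (x + y) ≤ max (v.1 x) (v.1 y) := FinitePlace.add_le v x y
  rcases le_total (v.1 x) (v.1 y) with hxy | hxy
  · rw [max_eq_right hxy] at h
    exact le_max_of_le_right (Real.rpow_le_rpow (v.1.nonneg _) h hw)
  · rw [max_eq_left hxy] at h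
    exact le_max_of_le_left (Real.rpow_le_rpow (v.1.nonneg _) h hw)

theorem nabs_inr_sum_le (v : FinitePlace K) {ι : Type*} (s : Finset ι) (f : ι → K) {b : ℝ}
    (hb : 0 ≤ b) (h : ∀ i ∈ s, Place.nabs (.inr v) (f i) ≤ b) :
    Place.nabs (.inr v) (∑ i ∈ s, f i) ≤ b := by
  classical
  induction s using Finset.induction_on with
  | empty => rwa [Finset.sum_empty, Place.nabs_zero]
  | insert i s hi ih =>
    rw [Finset.sum_insert hi]
    exact (nabs_inr_add_le v _ _).trans (max_le (h i (Finset.mem_insert_self _ _))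
      (ih fun j hj => h j (Finset.mem_insert_of_mem hj)))

theorem nabs_inr_le_one_of_isIntegral (v : FinitePlace K) {x : K} (hx : IsIntegral ℤ x) :
    Place.nabs (.inr v) x ≤ 1 := by
  refine Real.rpow_le_one (v.1.nonneg x) ?_ (Place.weight_pos (.inr v : Place K)).le
  have h := FinitePlace.norm_le_one K v.maximalIdeal (⟨x, hx⟩ : 𝓞 K)
  rwa [FinitePlace.norm_embedding_eq] at h

theorem nabs_inr_natCast_eq_one (v : FinitePlace K) {n : ℕ} (hn : ¬ residueChar v ∣ n) :
    Place.nabs (.inr v) (n : K) = 1 := by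
  have h := (FinitePlace.norm_eq_one_iff_notMem K v.maximalIdeal (n : 𝓞 K)).2 fun hmem => hn <| by
    rw [residueChar, ← CharP.cast_eq_zero_iff (𝓞 K ⧸ v.maximalIdeal.asIdeal)
      (ringChar (𝓞 K ⧸ v.maximalIdeal.asIdeal))]
    have := Ideal.Quotient.eq_zero_iff_mem.2 hmem
    simpa using this
  rw [FinitePlace.norm_embedding_eq, map_natCast] at h
  have h' : (Place.abv (.inr v : Place K)) (n : K) = 1 := h
  rw [Place.nabs, h', Real.one_rpow]

theorem nabs_inr_natCast_le_one (v : FinitePlace K) (n : ℕ) :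
    Place.nabs (.inr v) (n : K) ≤ 1 :=
  nabs_inr_le_one_of_isIntegral v (by simpa using isIntegral_algebraMap (R := ℤ) (A := K) (x := n))

theorem nabs_inr_intCast_le_one (v : FinitePlace K) (n : ℤ) :
    Place.nabs (.inr v) (n : K) ≤ 1 :=
  nabs_inr_le_one_of_isIntegral v (by simpa using isIntegral_algebraMap (R := ℤ) (A := K) (x := n))

theorem residueChar_prime (v : FinitePlace K) : (residueChar v).Prime := by
  exact (CharP.char_is_prime_or_zero (𝓞 K ⧸ v.maximalIdeal.asIdeal) (residueChar v)).resolve_right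
    (CharP.ringChar_ne_zero_of_finite _)

theorem one_le_radius (ω : ℚ) (v : Place K) : 1 ≤ radius ω v := by
  rcases v with v | v
  · exact le_rfl
  · rw [radius]
    split_ifs with h
    · have hp := residueChar_prime v
      have h1 : 1 ≤ (Place.nabs (.inr v) (ω.den : K))⁻¹ :=
        (one_le_inv₀ (Place.nabs_pos _ (by exact_mod_cast ω.den_nz))).2
          (nabs_inr_natCast_le_one v _)
      have h2 : 1 ≤ Place.nabs (.inr v) (residueChar v : K) ^
          (-(1 : ℝ) / ((residueChar v : ℝ) - 1)) := by
        refine Real.one_le_rpow_of_pos_of_le_one_of_nonpos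
          (Place.nabs_pos _ (by exact_mod_cast hp.ne_zero)) (nabs_inr_natCast_le_one v _) ?_
        have : (1 : ℝ) < residueChar v := by exact_mod_cast hp.one_lt
        exact div_nonpos_of_nonpos_of_nonneg (by norm_num) (by linarith)
      nlinarith
    · exact le_rfl

/-- The binomial coefficients of `ω` grow at most at the rate `radius ω v` at a finite place. -/
theorem nabs_inr_choose_le (ω : ℚ) (v : FinitePlace K) (m : ℕ) :
    Place.nabs (.inr v) ((Ring.choose ω m : ℚ) : K) ≤ radius ω (.inr v : Place K) ^ m := by
  obtain ⟨j, hj⟩ := exists_int_nuN_mul_choose ω (le_refl m)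
  have h1 : Place.nabs (.inr v) ((nuN m ω : ℕ) : K) *
      Place.nabs (.inr v) ((Ring.choose ω m : ℚ) : K) ≤ 1 := by
    rw [← Place.nabs_mul]
    have : ((nuN m ω : ℕ) : K) * ((Ring.choose ω m : ℚ) : K) = (j : K) := by
      exact_mod_cast congrArg (Rat.cast (K := K)) hj
    rw [this]
    exact nabs_inr_intCast_le_one v j
  have hpos : 0 < Place.nabs (.inr v) ((nuN m ω : ℕ) : K) :=
    Place.nabs_pos _ (by exact_mod_cast (nuN_pos m ω).ne')
  refine ((le_div_iff₀' hpos).2 h1).trans ?_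
  rw [one_div]
  have hp := residueChar_prime v
  -- a prime different from the residue characteristic is a unit at `v`
  have hq : ∀ q : ℕ, q.Prime → q ≠ residueChar v → Place.nabs (.inr v) (q : K) = 1 :=
    fun q hq hne => nabs_inr_natCast_eq_one v fun hd =>
      hne ((Nat.prime_dvd_prime_iff_eq hp hq).1 hd).symm
  have hprod : ∀ (s : Finset ℕ), (∀ q ∈ s, q.Prime) → residueChar v ∉ s →
      Place.nabs (.inr v) ((∏ q ∈ s, q ^ (m / (q - 1)) : ℕ) : K) = 1 := by
    intro s hs hsp
    refine nabs_inr_natCast_eq_one v fun hd => ?_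
    obtain ⟨q, hqs, hqd⟩ := (hp.prime.dvd_finsetProd_iff _).1 hd
    have := (Nat.prime_dvd_prime_iff_eq hp (hs q hqs)).1 (hp.dvd_of_dvd_pow hqd)
    exact hsp (this ▸ hqs)
  rw [radius]
  split_ifs with h
  · have hmem : residueChar v ∈ ω.den.primeFactors := Nat.mem_primeFactors.2 ⟨hp, h, ω.den_nz⟩
    rw [nuN, ← Finset.mul_prod_erase _ _ hmem]
    have hP := hprod (ω.den.primeFactors.erase (residueChar v))
      (fun q hq => Nat.prime_of_mem_primeFactors (Finset.mem_of_mem_erase hq))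
      (Finset.notMem_erase _ _)
    rw [Nat.cast_mul, Nat.cast_mul, Place.nabs_mul, Place.nabs_mul, hP, mul_one, Nat.cast_pow,
      Nat.cast_pow, Place.nabs_pow, Place.nabs_pow, mul_inv, mul_pow, inv_pow]
    have hpp : 0 < Place.nabs (.inr v) (residueChar v : K) :=
      Place.nabs_pos _ (by exact_mod_cast hp.ne_zero)
    refine mul_le_mul_of_nonneg_left ?_ (inv_nonneg.2 (pow_nonneg (Place.nabs_nonneg _ _) _))
    rw [← Real.rpow_natCast, ← Real.rpow_natCast, ← Real.rpow_neg hpp.le, ← Real.rpow_mul hpp.le]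
    refine Real.rpow_le_rpow_of_exponent_ge hpp (nabs_inr_natCast_le_one v _) ?_
    have hc := Nat.cast_div_le (α := ℝ) (m := m) (n := residueChar v - 1)
    rw [Nat.cast_sub hp.one_lt.le, Nat.cast_one] at hc
    rw [neg_div, neg_mul, one_div_mul_eq_div]
    exact neg_le_neg hc
  · have hP := hprod ω.den.primeFactors (fun q hq => Nat.prime_of_mem_primeFactors hq)
      (fun hm => h (Nat.dvd_of_mem_primeFactors hm))
    rw [nuN, Nat.cast_mul, Place.nabs_mul, hP, Nat.cast_pow, Place.nabs_pow,
      nabs_inr_natCast_eq_one v h]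
    simp

theorem map_denVal {F E : Type*} [Field F] [Field E] [CharZero F] [CharZero E] (φ : F →+* E)
    (ω : ℚ) (y : F) (n : ℕ) : φ (denVal ω y n) = denVal ω (φ y) n := by
  simp [denVal, coeffSum]

theorem map_numVal {F E : Type*} [Field F] [Field E] [CharZero F] [CharZero E] (φ : F →+* E)
    (ω : ℚ) (y : F) (n : ℕ) : φ (numVal ω y n) = numVal ω (φ y) n := by
  simp [numVal, coeffSum]

theorem ne_zero_of_radius_lt {ω : ℚ} {β : K} {v : Place K} (hβ : radius ω v < v.nabs β) :
    β ≠ 0 := fun h => by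
  rw [h, v.nabs_zero] at hβ
  linarith [one_le_radius ω v]

theorem abv_inl (v : InfinitePlace K) (x : K) :
    Place.abv (.inl v) x = ‖v.embedding x‖ := (v.norm_embedding_eq x).symm

theorem one_lt_norm_embedding {ω : ℚ} {β : K} {v : InfinitePlace K}
    (hβ : radius ω (.inl v) < Place.nabs (.inl v) β) : 1 < ‖v.embedding β‖ := by
  rw [← abv_inl, Place.abv_eq]
  exact Real.one_lt_rpow hβ (inv_pos.2 (Place.weight_pos _))

/-- The binomial series converges under the assumption on `β`, so that `binomValue` is its sum. -/
theorem hasSum_binomValue {ω : ℚ} {β : K} {v : Place K} (hβ : radius ω v < v.nabs β) :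
    HasSum (fun m : ℕ => ((Ring.choose ω m : ℚ) : v.abv.Completion) * (v.coeHom (-β))⁻¹ ^ m)
      (binomValue v ω β) := by
  have hβ0 := ne_zero_of_radius_lt hβ
  have hterm : ∀ m : ℕ, v.coe (((Ring.choose ω m : ℚ) : K) * (-1 / β) ^ m) =
      ((Ring.choose ω m : ℚ) : v.abv.Completion) * (v.coeHom (-β))⁻¹ ^ m := by
    intro m
    rw [v.coe_eq_coeHom, map_mul, map_ratCast, map_pow, ← map_inv₀, neg_div, one_div, inv_neg]
  have hnorm : ∀ m : ℕ, ‖v.coe (((Ring.choose ω m : ℚ) : K) * (-1 / β) ^ m)‖ =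
      v.abv ((Ring.choose ω m : ℚ) : K) * (v.abv β)⁻¹ ^ m := by
    intro m
    rw [v.coe_eq_coeHom, v.norm_coeHom, map_mul, map_pow, neg_div, AbsoluteValue.map_neg, one_div,
      map_inv₀]
  have hsum : Summable fun m : ℕ => v.coe (((Ring.choose ω m : ℚ) : K) * (-1 / β) ^ m) := by
    rcases v with v | v
    · have h1 := one_lt_norm_embedding hβ
      obtain ⟨a, ha1, ha⟩ := exists_between h1
      obtain ⟨C, hC, h⟩ := exists_abs_choose_le ω ha1
      have hq : a / ‖v.embedding β‖ < 1 := (div_lt_one (one_pos.trans h1)).2 ha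
      refine Summable.of_norm_bounded ((summable_geometric_of_lt_one
        (div_nonneg (one_pos.trans ha1).le (norm_nonneg _)) hq).mul_left C) fun m => ?_
      rw [hnorm, abv_inl, abv_inl, map_ratCast, div_pow, ← Complex.ofReal_ratCast,
        Complex.norm_real, Real.norm_eq_abs, inv_pow, div_eq_mul_inv, ← mul_assoc]
      gcongr
      exact h m
    · have hr := one_le_radius ω (.inr v : Place K)
      have hb : 0 < Place.nabs (.inr v) β := Place.nabs_pos _ hβ0
      have hw := inv_pos.2 (Place.weight_pos (.inr v : Place K))
      have hq0 : 0 ≤ radius ω (.inr v : Place K) / Place.nabs (.inr v) β := by positivity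
      have hq : (radius ω (.inr v : Place K) / Place.nabs (.inr v) β) ^
          ((Place.weight (.inr v : Place K))⁻¹) < 1 :=
        Real.rpow_lt_one hq0 ((div_lt_one hb).2 hβ) hw
      refine Summable.of_norm_bounded (summable_geometric_of_lt_one
        (Real.rpow_nonneg hq0 _) hq) fun m => ?_
      rw [hnorm, ← map_inv₀, ← map_pow, ← map_mul, Place.abv_eq, ← Real.rpow_natCast,
        ← Real.rpow_mul hq0, mul_comm _ (m : ℝ), Real.rpow_mul hq0, Real.rpow_natCast]
      refine Real.rpow_le_rpow (Place.nabs_nonneg _ _) ?_ hw.le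
      rw [Place.nabs_mul, Place.nabs_pow, Place.nabs_inv, div_pow, inv_pow, div_eq_mul_inv]
      gcongr
      exact nabs_inr_choose_le ω v m
  have h := hsum.hasSum
  rw [funext hterm] at h
  have he : binomValue v ω β =
      ∑' m : ℕ, ((Ring.choose ω m : ℚ) : v.abv.Completion) * (v.coeHom (-β))⁻¹ ^ m :=
    tsum_congr hterm
  rw [he]
  exact h

end Places

/-! ### Integral approximants and their size at each place -/

section Integral

variable {K : Type*} [Field K] {ω : ℚ} {β : K}

theorem exists_int_denCoeff (hω : ω ∉ Set.range ((↑) : ℤ → ℚ)) {n k : ℕ} (hk : k ≤ n) :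
    ∃ m : ℤ, (nuN n ω : ℚ) * denCoeff ω n k = (G n ω : ℚ) * m := by
  obtain ⟨m, hm⟩ := (G_mem n ω).2.1 k hk
  exact ⟨m, by rw [denCoeff_eq hω hk, ← mul_assoc, hm]⟩

theorem exists_int_numCoeff (hω : ω ∉ Set.range ((↑) : ℤ → ℚ)) {n k : ℕ} (hk : k < n) :
    ∃ m : ℤ, (nuN n ω : ℚ) * numCoeff ω n k = (G n ω : ℚ) * m := by
  obtain ⟨m, hm⟩ := (G_mem n ω).2.2 k hk
  exact ⟨m, by rw [numCoeff_eq hω hk, ← mul_assoc, hm]⟩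

/-- The `n`-th denominator at `β`, scaled to be an algebraic integer. -/
noncomputable def intDen (ω : ℚ) (β : K) (n : ℕ) : K :=
  (commonDen ω β n : K) * denVal ω (-β) n

/-- The `n`-th numerator at `β`, scaled to be an algebraic integer. -/
noncomputable def intNum (ω : ℚ) (β : K) (n : ℕ) : K :=
  (commonDen ω β n : K) * (-β * numVal ω (-β) n)

theorem commonDen_mul_eq {n : ℕ} {c : ℚ} {m : ℤ} (h : (nuN n ω : ℚ) * c = (G n ω : ℚ) * m) :
    commonDen ω β n * c = (den β : ℚ) ^ n * m := by
  have hG : (G n ω : ℚ) ≠ 0 := by exact_mod_cast (G_pos n ω).ne'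
  rw [commonDen, div_mul_eq_mul_div, div_eq_iff hG]
  linear_combination (den β : ℚ) ^ n * h

variable [NumberField K]

theorem isIntegral_commonDen_mul {n j : ℕ} (hj : j ≤ n) {c : ℚ} {m : ℤ}
    (h : (nuN n ω : ℚ) * c = (G n ω : ℚ) * m) :
    IsIntegral ℤ ((commonDen ω β n : K) * ((c : K) * (-β) ^ j)) := by
  have e : (commonDen ω β n : K) * ((c : K) * (-β) ^ j) =
      (m : K) * ((den β : K) ^ (n - j) * (-((den β : K) * β)) ^ j) := by
    have h1 := congrArg (Rat.cast (K := K)) (commonDen_mul_eq (β := β) h)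
    push_cast at h1
    rw [← mul_assoc, h1, ← pow_sub_mul_pow _ hj, ← mul_neg, mul_pow]
    ring
  rw [e]
  have hd : IsIntegral ℤ (den β : K) := by
    simpa using isIntegral_algebraMap (R := ℤ) (A := K) (x := den β)
  have hm : IsIntegral ℤ (m : K) := by
    simpa using isIntegral_algebraMap (R := ℤ) (A := K) (x := m)
  exact hm.mul ((hd.pow _).mul ((den_spec β).2.neg.pow _))

theorem isIntegral_intDen (hω : ω ∉ Set.range ((↑) : ℤ → ℚ)) (n : ℕ) :
    IsIntegral ℤ (intDen ω β n) := by
  rw [intDen, denVal, coeffSum, Finset.mul_sum]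
  refine IsIntegral.sum _ fun k hk => ?_
  have hk' : k ≤ n := Nat.lt_succ_iff.1 (Finset.mem_range.1 hk)
  obtain ⟨m, hm⟩ := exists_int_denCoeff hω hk'
  exact isIntegral_commonDen_mul hk' hm

theorem isIntegral_intNum (hω : ω ∉ Set.range ((↑) : ℤ → ℚ)) (n : ℕ) :
    IsIntegral ℤ (intNum ω β n) := by
  rw [intNum, numVal, coeffSum, Finset.mul_sum, Finset.mul_sum]
  refine IsIntegral.sum _ fun k hk => ?_
  rcases (Nat.lt_succ_iff.1 (Finset.mem_range.1 hk)).lt_or_eq with hk' | rfl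
  · obtain ⟨m, hm⟩ := exists_int_numCoeff hω hk'
    have := isIntegral_commonDen_mul (β := β) (Nat.succ_le_of_lt hk') hm
    have e : (commonDen ω β n : K) * (-β * ((numCoeff ω n k : K) * (-β) ^ k)) =
        (commonDen ω β n : K) * ((numCoeff ω n k : K) * (-β) ^ (k + 1)) := by ring
    rw [e]
    exact this
  · rw [numCoeff_eq_zero le_rfl]
    simp [isIntegral_zero]

/-- The logarithmic growth rate of the integral approximants at an archimedean place. -/
noncomputable def growthRate (ω : ℚ) (β : K) (v : InfinitePlace K) : ℝ :=
  logRho₂ β v + Place.weight (.inl v : Place K) * Real.log (Delta ω β)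

/-- The logarithmic gap between the growth of the approximants and of the remainder at `v₀`. -/
noncomputable def gap (ω : ℚ) (β : K) : Place K → ℝ
  | .inl v => -(logRho₁ β v - logRho₂ β v)
  | .inr v => -Real.log (finiteDecay ω β v)

theorem nabs_inl_ratCast (v : InfinitePlace K) {q : ℚ} (hq : 0 ≤ q) :
    Place.abv (.inl v) (q : K) = q := by
  rw [abv_inl, map_ratCast, ← Complex.ofReal_ratCast, Complex.norm_real, Real.norm_eq_abs,
    abs_of_nonneg (by exact_mod_cast hq)]

/-- Passage from bounds for the ordinary absolute value to the normalized one, whose exponent is the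
weight `w ≤ 1`. -/
theorem rpow_mul_le_exp {w ρ D x C d η : ℝ} {n : ℕ} (hw0 : 0 ≤ w) (hw1 : w ≤ 1) (hρ : 0 < ρ)
    (hD0 : 0 ≤ D) (hx0 : 0 ≤ x) (hC : 0 ≤ C) (hη : 0 ≤ η) (hD : D ≤ Real.exp (n * (d + η / 2)))
    (hx : x ≤ C * (ρ * Real.exp (η / 2)) ^ n) :
    (D * x) ^ w ≤ C ^ w * Real.exp (n * (w * Real.log ρ + w * d + η)) := by
  have hx' : x ≤ C * Real.exp (n * (Real.log ρ + η / 2)) := by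
    rwa [Real.exp_nat_mul, Real.exp_add, Real.exp_log hρ]
  calc (D * x) ^ w ≤ (Real.exp (n * (d + η / 2)) * (C * Real.exp (n * (Real.log ρ + η / 2)))) ^ w :=
        Real.rpow_le_rpow (mul_nonneg hD0 hx0) (by gcongr) hw0
    _ = (C * Real.exp (n * (Real.log ρ + d + η))) ^ w := by
        rw [mul_left_comm, ← Real.exp_add]
        ring_nf
    _ = C ^ w * Real.exp (w * (n * (Real.log ρ + d + η))) := by
        rw [Real.mul_rpow hC (Real.exp_pos _).le, ← Real.exp_mul, mul_comm w]
    _ ≤ _ := by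
        refine mul_le_mul_of_nonneg_left (Real.exp_le_exp.2 ?_) (Real.rpow_nonneg hC _)
        have h : (0 : ℝ) ≤ n * η * (1 - w) :=
          mul_nonneg (mul_nonneg (Nat.cast_nonneg n) hη) (by linarith)
        linarith

theorem JacobiRec.sub_mul {F : Type*} [Field F] {y : F} {u w : ℕ → F} (hu : JacobiRec ω y u)
    (hw : JacobiRec ω y w) (a b : F) : JacobiRec ω y fun n => u n * a - b * w n := by
  intro n
  linear_combination a * hu n - b * hw n

theorem lt_mul_exp_half {ρ η : ℝ} (hρ : 0 < ρ) (hη : 0 < η) : ρ < ρ * Real.exp (η / 2) :=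
  lt_mul_of_one_lt_right hρ (Real.one_lt_exp_iff.2 (half_pos hη))

/-- The integral approximants grow at most at the rate `growthRate` at an archimedean place. -/
theorem exists_nabs_inl_le (hω : ω ∉ Set.range ((↑) : ℤ → ℚ)) (v : InfinitePlace K) {η : ℝ}
    (hη : 0 < η) : ∃ c, 0 < c ∧ ∀ᶠ n : ℕ in atTop,
      Place.nabs (.inl v) (intDen ω β n) ≤ c * Real.exp (n * (growthRate ω β v + η)) ∧
      Place.nabs (.inl v) (intNum ω β n) ≤ c * Real.exp (n * (growthRate ω β v + η)) := by
  set z := v.embedding β with hz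
  have hρ := rho₂_pos z
  set w := Place.weight (.inl v : Place K) with hw
  have hw0 : 0 < w := Place.weight_pos _
  obtain ⟨C₁, hC₁, h₁⟩ :=
    (denVal_rec hω (-z)).exists_norm_le_of_rho₂_lt (lt_mul_exp_half hρ hη)
  obtain ⟨C₂, hC₂, h₂⟩ :=
    (numVal_rec hω (-z)).exists_norm_le_of_rho₂_lt (lt_mul_exp_half hρ hη)
  refine ⟨C₁ ^ w + (‖z‖ * C₂) ^ w, by positivity, ?_⟩
  filter_upwards [commonDen_le ω β (half_pos hη)] with n hn
  have hD0 : (0 : ℝ) ≤ commonDen ω β n := by exact_mod_cast (commonDen_pos ω β n).le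
  have e1 : Place.nabs (.inl v) (intDen ω β n) =
      ((commonDen ω β n : ℝ) * ‖denVal ω (-z) n‖) ^ w := by
    rw [intDen, Place.nabs, map_mul, nabs_inl_ratCast v (commonDen_pos ω β n).le, abv_inl,
      map_denVal, map_neg]
  have e2 : Place.nabs (.inl v) (intNum ω β n) =
      ((commonDen ω β n : ℝ) * (‖z‖ * ‖numVal ω (-z) n‖)) ^ w := by
    rw [intNum, Place.nabs, map_mul, map_mul, nabs_inl_ratCast v (commonDen_pos ω β n).le,
      AbsoluteValue.map_neg, abv_inl, abv_inl, map_numVal, map_neg]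
  have hrate : growthRate ω β v = w * Real.log (rho₂ 1 z) + w * Real.log (Delta ω β) := rfl
  rw [e1, e2, hrate]
  constructor
  · refine (rpow_mul_le_exp hw0.le (Place.weight_le_one _) hρ hD0 (norm_nonneg _) hC₁.le hη.le hn
      (h₁ n)).trans ?_
    gcongr
    exact le_add_of_nonneg_right (by positivity)
  · refine (rpow_mul_le_exp hw0.le (Place.weight_le_one _) hρ hD0 (by positivity)
      (C := ‖z‖ * C₂) (by positivity) hη.le hn ?_).trans ?_
    · rw [mul_assoc]
      exact mul_le_mul_of_nonneg_left (h₂ n) (norm_nonneg _)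
    · gcongr
      exact le_add_of_nonneg_left (by positivity)

/-- The remainder, scaled by the common denominator. -/
theorem coeHom_intDen_mul_sub (v : Place K) (θ : v.abv.Completion) (n : ℕ) :
    v.coeHom (intDen ω β n) * θ - v.coeHom (intNum ω β n) =
      v.coeHom (commonDen ω β n : K) * (denVal ω (v.coeHom (-β)) n * θ -
        v.coeHom (-β) * numVal ω (v.coeHom (-β)) n) := by
  rw [intDen, intNum, map_mul, map_mul, map_mul, map_denVal, map_numVal]
  ring

/-- At an archimedean place with `|β| > 1` the scaled remainder is smaller than the approximants by
the factor `exp (-n * gap)`. -/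
theorem exists_nabsCompletion_inl_le (hω : ω ∉ Set.range ((↑) : ℤ → ℚ)) (v : InfinitePlace K)
    (hβ : radius ω (.inl v) < Place.nabs (.inl v) β) {η : ℝ} (hη : 0 < η) :
    ∃ c, 0 < c ∧ ∀ᶠ n : ℕ in atTop,
      Place.nabsCompletion (.inl v) (Place.coeHom (.inl v) (intDen ω β n) *
        binomValue (.inl v) ω β - Place.coeHom (.inl v) (intNum ω β n)) ≤
      c * Real.exp (n * (growthRate ω β v - gap ω β (.inl v) + η)) := by
  set z := v.embedding β with hz
  have hz1 : 1 < ‖z‖ := one_lt_norm_embedding hβ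
  have hρ := rho₁_pos z
  set w := Place.weight (.inl v : Place K) with hw
  have hw0 : 0 < w := Place.weight_pos _
  -- the isometric embedding of the completion into `ℂ`
  obtain ⟨ι, hι, hιK⟩ : ∃ ι : (Place.abv (.inl v : Place K)).Completion →+* ℂ, Isometry ι ∧
      ∀ x : K, ι (Place.coeHom (.inl v) x) = v.embedding x :=
    ⟨v.isometry_embedding.extensionHom, v.isometry_embedding.completion_extension,
      fun x => v.isometry_embedding.extensionHom_coe _⟩
  set θ := binomValue (.inl v) ω β with hθ
  have hsum : HasSum (fun m : ℕ => ((Ring.choose ω m : ℚ) : ℂ) * (-z)⁻¹ ^ m) (ι θ) := by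
    have h := (hasSum_binomValue hβ).map ι hι.continuous
    have e : (fun m : ℕ => ((Ring.choose ω m : ℚ) : ℂ) * (-z)⁻¹ ^ m) = ι ∘ fun m : ℕ =>
        ((Ring.choose ω m : ℚ) : (Place.abv (.inl v : Place K)).Completion) *
          (Place.coeHom (.inl v) (-β))⁻¹ ^ m := by
      funext m
      rw [Function.comp_apply, map_mul, map_pow, map_inv₀, hιK, map_ratCast, map_neg]
    rw [e]
    exact h
  have hy1 : 1 < ‖-z‖ := by rwa [norm_neg]
  obtain ⟨B, hB⟩ := exists_norm_remainder_le hω hy1 hsum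
  obtain ⟨C, hC, h⟩ := ((denVal_rec hω (-z)).sub_mul (numVal_rec hω (-z)) (ι θ)
    (-z)).exists_norm_le_of_rho₁_lt hz1 hB (lt_mul_exp_half hρ hη)
  refine ⟨C ^ w, by positivity, ?_⟩
  filter_upwards [commonDen_le ω β (half_pos hη)] with n hn
  have hD0 : (0 : ℝ) ≤ commonDen ω β n := by exact_mod_cast (commonDen_pos ω β n).le
  have e : Place.nabsCompletion (.inl v) (Place.coeHom (.inl v) (intDen ω β n) * θ -
      Place.coeHom (.inl v) (intNum ω β n)) =
        ((commonDen ω β n : ℝ) * ‖denVal ω (-z) n * ι θ - -z * numVal ω (-z) n‖) ^ w := by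
    rw [coeHom_intDen_mul_sub, Place.nabsCompletion, norm_mul, Place.norm_coeHom,
      nabs_inl_ratCast v (commonDen_pos ω β n).le,
      ← hι.norm_map_of_map_zero (map_zero ι) (_ - _), map_sub, map_mul, map_mul, map_denVal,
      map_numVal, hιK, map_neg]
  have hrate : growthRate ω β v - gap ω β (.inl v) =
      w * Real.log (rho₁ 1 z) + w * Real.log (Delta ω β) := by
    rw [growthRate, gap]
    have : logRho₁ β v = w * Real.log (rho₁ 1 z) := rfl
    linarith
  rw [e, hrate]
  exact rpow_mul_le_exp hw0.le (Place.weight_le_one _) hρ hD0 (norm_nonneg _) hC.le hη.le hn (h n)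

theorem finiteDecay_pos (v : FinitePlace K) (hβ : β ≠ 0) : 0 < finiteDecay ω β v := by
  have h1 := one_le_radius ω (.inr v : Place K)
  have h2 : ((den β : K) / β) ≠ 0 :=
    div_ne_zero (by exact_mod_cast Nat.one_le_iff_ne_zero.1 (den_spec β).1) hβ
  exact mul_pos (by positivity) (Place.nabs_pos _ h2)

/-- Each term of the scaled remainder series is small at a finite place: the common divisor is
removed by expressing the coefficients of the remainder through those of the denominator. -/
theorem nabs_inr_remainder_term_le (hω : ω ∉ Set.range ((↑) : ℤ → ℚ)) (v : FinitePlace K)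
    (hβ : radius ω (.inr v) < Place.nabs (.inr v) β) (n m : ℕ) :
    Place.nabs (.inr v) ((commonDen ω β n : K) * ((remCoeff ω n m : K) * (-β)⁻¹ ^ m)) ≤
      finiteDecay ω β v ^ n := by
  have hβ0 := ne_zero_of_radius_lt hβ
  set r := radius ω (.inr v : Place K) with hr
  have hr1 : 1 ≤ r := one_le_radius ω _
  have hb : 0 < Place.nabs (.inr v) β := Place.nabs_pos _ hβ0
  rcases lt_or_ge m n with hmn | hmn
  · rw [remCoeff_eq_zero hmn]
    simp only [Rat.cast_zero, zero_mul, mul_zero, Place.nabs_zero]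
    exact pow_nonneg (finiteDecay_pos v hβ0).le n
  have hd0 := Place.nabs_nonneg (.inr v) (den β : K)
  have hcoef : Place.nabs (.inr v) ((commonDen ω β n : K) * (remCoeff ω n m : K)) ≤
      Place.nabs (.inr v) (den β : K) ^ n * r ^ (m + n) := by
    rw [← coeffSum_choose hω, coeffSum, Rat.cast_sum, Finset.mul_sum]
    refine nabs_inr_sum_le v _ _ (by positivity) fun k hk => ?_
    have hk' : k ≤ n := Nat.lt_succ_iff.1 (Finset.mem_range.1 hk)
    obtain ⟨j, hj⟩ := exists_int_denCoeff hω hk'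
    have h1 := congrArg (Rat.cast (K := K)) (commonDen_mul_eq (β := β) hj)
    push_cast at h1
    rw [Rat.cast_mul, Rat.cast_id, ← mul_assoc, h1, Place.nabs_mul, Place.nabs_mul, Place.nabs_pow]
    have hj1 := nabs_inr_intCast_le_one v j
    have hc := nabs_inr_choose_le ω v (m + k)
    have hj0 := Place.nabs_nonneg (.inr v) (j : K)
    have hc0 := Place.nabs_nonneg (.inr v) ((Ring.choose ω (m + k) : ℚ) : K)
    calc _ ≤ Place.nabs (.inr v) (den β : K) ^ n * 1 * r ^ (m + k) := by gcongr
      _ = Place.nabs (.inr v) (den β : K) ^ n * r ^ (m + k) := by rw [mul_one]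
      _ ≤ _ := by gcongr
  have hrb : (r / Place.nabs (.inr v) β) ^ (m - n) ≤ 1 :=
    pow_le_one₀ (by positivity) ((div_le_one hb).2 hβ.le)
  rw [← mul_assoc, Place.nabs_mul, Place.nabs_pow, Place.nabs_inv, Place.nabs_neg]
  calc _ ≤ Place.nabs (.inr v) (den β : K) ^ n * r ^ (m + n) * (Place.nabs (.inr v) β)⁻¹ ^ m := by
        gcongr
    _ = finiteDecay ω β v ^ n * (r / Place.nabs (.inr v) β) ^ (m - n) := by
        obtain ⟨l, rfl⟩ := Nat.exists_eq_add_of_le hmn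
        rw [Nat.add_sub_cancel_left, finiteDecay, ← hr, Place.nabs_div]
        simp only [mul_pow, div_pow, pow_add, inv_pow]
        field_simp
        ring
    _ ≤ finiteDecay ω β v ^ n * 1 := by
        have := (finiteDecay_pos (ω := ω) v hβ0).le
        gcongr
    _ = _ := mul_one _

theorem nabsCompletion_inr_le (hω : ω ∉ Set.range ((↑) : ℤ → ℚ)) (v : FinitePlace K)
    (hβ : radius ω (.inr v) < Place.nabs (.inr v) β) (n : ℕ) :
    Place.nabsCompletion (.inr v) (Place.coeHom (.inr v) (intDen ω β n) *
      binomValue (.inr v) ω β - Place.coeHom (.inr v) (intNum ω β n)) ≤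
        finiteDecay ω β v ^ n := by
  have hβ0 := ne_zero_of_radius_lt hβ
  have hy : Place.coeHom (.inr v) (-β) ≠ 0 := by
    rw [map_ne_zero]
    exact neg_ne_zero.2 hβ0
  have h := (hasSum_remainder hω hy (hasSum_binomValue hβ) n).mul_left
    (Place.coeHom (.inr v) (commonDen ω β n : K))
  rw [coeHom_intDen_mul_sub]
  have hlim := (h.tendsto_sum_nat.norm).rpow_const
    (p := Place.weight (.inr v : Place K)) (Or.inr (Place.weight_pos _).le)
  refine le_of_tendsto' hlim fun N => ?_
  have e : ∑ m ∈ Finset.range N, Place.coeHom (.inr v) (commonDen ω β n : K) *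
      ((remCoeff ω n m : (Place.abv (.inr v : Place K)).Completion) *
        (Place.coeHom (.inr v) (-β))⁻¹ ^ m) =
      Place.coeHom (.inr v) (∑ m ∈ Finset.range N,
        (commonDen ω β n : K) * ((remCoeff ω n m : K) * (-β)⁻¹ ^ m)) := by
    rw [map_sum]
    refine Finset.sum_congr rfl fun m _ => ?_
    rw [map_mul, map_mul, map_pow, map_inv₀, map_ratCast _ (remCoeff ω n m)]
  rw [e]
  have h2 := nabs_inr_sum_le v (Finset.range N)
    (fun m => (commonDen ω β n : K) * ((remCoeff ω n m : K) * (-β)⁻¹ ^ m))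
    (pow_nonneg (finiteDecay_pos (ω := ω) v hβ0).le n)
    fun m _ => nabs_inr_remainder_term_le hω v hβ n m
  rw [← Place.nabsCompletion_coeHom] at h2
  exact h2

end Integral

/-! ### The product formula and heights -/

section Heights

variable {K : Type*} [Field K] [NumberField K]

theorem one_le_localHeight (v : Place K) (x y : K) : 1 ≤ localHeight v x y := le_max_left _ _

theorem nabs_le_localHeight_left (v : Place K) (x y : K) : v.nabs x ≤ localHeight v x y :=
  (le_max_left _ _).trans (le_max_right _ _)

theorem nabs_le_localHeight_right (v : Place K) (x y : K) : v.nabs y ≤ localHeight v x y :=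
  (le_max_right _ _).trans (le_max_right _ _)

theorem finite_nabs_ne_one {x : K} (hx : x ≠ 0) :
    {v : FinitePlace K | Place.nabs (.inr v) x ≠ 1}.Finite := by
  refine (FinitePlace.hasFiniteMulSupport hx).subset fun v hv => ?_
  rw [Function.mem_mulSupport]
  intro h
  have h' : Place.abv (.inr v) x = 1 := h
  exact hv (by rw [Place.nabs, h', Real.one_rpow])

theorem finite_localHeight_ne_one (x y : K) :
    {v : FinitePlace K | localHeight (.inr v) x y ≠ 1}.Finite := by
  have key : ∀ x : K, {v : FinitePlace K | ¬ Place.nabs (.inr v) x ≤ 1}.Finite := by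
    intro x
    by_cases hx : x = 0
    · simp [hx, Place.nabs_zero]
    · exact (finite_nabs_ne_one hx).subset fun v hv h => hv h.le
  refine ((key x).union (key y)).subset fun v hv => ?_
  by_contra h
  simp only [Set.mem_union, Set.mem_ofPred_eq, not_or, not_not] at h
  exact hv (max_eq_left (max_le h.1 h.2))

/-- The product formula for the normalized absolute values, over a finite set of finite places
outside which the element is a unit. -/
theorem prod_nabs_mul_prod_nabs {x : K} (hx : x ≠ 0) (T : Finset (FinitePlace K))
    (hT : ∀ v ∉ T, Place.nabs (.inr v) x = 1) :
    (∏ v : InfinitePlace K, Place.nabs (.inl v) x) * ∏ v ∈ T, Place.nabs (.inr v) x = 1 := by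
  set d : ℝ := (Module.finrank ℚ K : ℝ) with hd
  have h1 : ∀ v : InfinitePlace K, Place.nabs (.inl v) x = (v x ^ v.mult) ^ (1 / d) := by
    intro v
    rw [← Real.rpow_natCast, ← Real.rpow_mul (apply_nonneg v x), mul_one_div]
    rfl
  have h2 : ∏ᶠ v : FinitePlace K, v x = ∏ v ∈ T, v x := by
    refine finprod_eq_prod_of_mulSupport_subset _ fun v hv => ?_
    by_contra hvT
    have h := Place.abv_eq (.inr v) x
    rw [hT v hvT, Real.one_rpow] at h
    exact hv h
  have h := prod_abs_eq_one hx
  rw [h2] at h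
  have h3 := congrArg (· ^ (1 / d)) h
  simp only [Real.one_rpow] at h3
  rw [Real.mul_rpow (Finset.prod_nonneg fun v _ => pow_nonneg (v.1.nonneg x) _)
    (Finset.prod_nonneg fun v _ => v.1.nonneg x),
    ← Real.finsetProd_rpow _ _ (fun v _ => pow_nonneg (v.1.nonneg x) _),
    ← Real.finsetProd_rpow _ _ (fun v _ => v.1.nonneg x)] at h3
  simp only [h1]
  exact h3

theorem one_le_height (x y : K) : 1 ≤ height x y := by
  refine one_le_mul_of_one_le_of_one_le
    ?_ (finprod_induction (1 ≤ ·) le_rfl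
      (fun _ _ => one_le_mul_of_one_le_of_one_le) fun _ => one_le_localHeight _ _ _)
  exact Finset.prod_induction _ (1 ≤ ·) (fun _ _ => one_le_mul_of_one_le_of_one_le) le_rfl
    fun _ _ => one_le_localHeight _ _ _

/-- The product formula bounds `|δ|_{v₀}` from below in terms of upper bounds at all other
places. -/
theorem mul_localHeight_le (v₀ : Place K) {δ : K} (hδ : δ ≠ 0) (x y : K)
    (B : InfinitePlace K → ℝ) (hB : ∀ v, 0 < B v)
    (hinf : ∀ v : InfinitePlace K, Sum.inl v ≠ v₀ →
      Place.nabs (.inl v) δ ≤ B v * localHeight (.inl v) x y)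
    (hfin : ∀ v : FinitePlace K, Sum.inr v ≠ v₀ →
      Place.nabs (.inr v) δ ≤ localHeight (.inr v) x y) :
    Sum.elim B (fun _ => 1) v₀ * localHeight v₀ x y ≤
      v₀.nabs δ * ((∏ v, B v) * height x y) := by
  classical
  set T₀ : Finset (FinitePlace K) :=
    (finite_nabs_ne_one hδ).toFinset ∪ (finite_localHeight_ne_one x y).toFinset with hT₀
  set T : Finset (FinitePlace K) := T₀ ∪ v₀.elim (fun _ => ∅) (fun v => {v}) with hT
  have hTδ : ∀ v ∉ T, Place.nabs (.inr v) δ = 1 := by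
    intro v hv
    by_contra h
    exact hv (Finset.mem_union_left _ (Finset.mem_union_left _ (by simpa using h)))
  have hTh : height x y = (∏ v : InfinitePlace K, localHeight (.inl v) x y) *
      ∏ v ∈ T, localHeight (.inr v) x y := by
    rw [height, finprod_eq_prod_of_mulSupport_subset _ fun v hv => ?_]
    exact Finset.mem_union_left _ (Finset.mem_union_right _ (by simpa using hv))
  set S : Finset (Place K) := Finset.univ.disjSum T with hS
  have hv₀ : v₀ ∈ S := by
    rcases v₀ with v | v
    · simp [hS]
    · simp [hS, hT]
  set b : Place K → ℝ := Sum.elim B (fun _ => 1) with hb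
  have hbpos : ∀ v, 0 < b v := by
    rintro (v | v)
    · exact hB v
    · exact one_pos
  have hprod : ∏ v ∈ S, v.nabs δ = 1 := by
    rw [hS, Finset.prod_disjSum]
    exact prod_nabs_mul_prod_nabs hδ T hTδ
  have hH : ∏ v ∈ S, b v * localHeight v x y = (∏ v, B v) * height x y := by
    rw [hS, Finset.prod_disjSum, Finset.prod_mul_distrib, hTh]
    simp only [hb, Sum.elim_inl, Sum.elim_inr, one_mul]
    ring
  have hle : ∏ v ∈ S.erase v₀, v.nabs δ ≤ ∏ v ∈ S.erase v₀, b v * localHeight v x y := by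
    refine Finset.prod_le_prod (fun v _ => v.nabs_nonneg δ) fun v hv => ?_
    have hne := Finset.ne_of_mem_erase hv
    rcases v with v | v
    · exact hinf v hne
    · simpa [hb] using hfin v hne
  rw [← Finset.mul_prod_erase S _ hv₀] at hprod hH
  have hLpos : 0 < b v₀ * localHeight v₀ x y :=
    mul_pos (hbpos v₀) (one_pos.trans_le (one_le_localHeight _ _ _))
  rw [← hH]
  calc b v₀ * localHeight v₀ x y =
        (b v₀ * localHeight v₀ x y) * (v₀.nabs δ * ∏ v ∈ S.erase v₀, v.nabs δ) := by
          rw [hprod, mul_one]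
    _ ≤ (b v₀ * localHeight v₀ x y) *
          (v₀.nabs δ * ∏ v ∈ S.erase v₀, b v * localHeight v x y) := by
        have := v₀.nabs_nonneg δ
        gcongr
    _ = _ := by ring

end Heights

/-! ### The fundamental inequality -/

section Inequality

variable {K : Type*} [Field K] [NumberField K] {ω : ℚ} {β : K}

theorem V_eq (v₀ : Place K) :
    V ω β v₀ = gap ω β v₀ - ∑ v : InfinitePlace K, growthRate ω β v := by
  classical
  have hsum : ∑ v : InfinitePlace K, growthRate ω β v =
      ∑ v : InfinitePlace K, logRho₂ β v + Real.log (Delta ω β) := by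
    simp only [growthRate, Finset.sum_add_distrib, ← Finset.sum_mul]
    have : ∑ v : InfinitePlace K, Place.weight (.inl v : Place K) = 1 := sum_mult_div_finrank
    rw [this, one_mul]
  rw [hsum]
  rcases v₀ with v | v
  · have h := Finset.add_sum_erase Finset.univ (logRho₂ β) (Finset.mem_univ v)
    rw [← h]
    have hV : V ω β (.inl v) = -logRho₁ β v - Real.log (Delta ω β) -
      ∑ v ∈ Finset.univ.erase v, logRho₂ β v := by
        rw [V]
    rw [hV, gap]
    ring
  · rw [V, gap]
    ring

theorem mu_eq (v₀ : Place K) (ε : ℝ) : mu ω β v₀ ε = gap ω β v₀ / (V ω β v₀ - ε) := by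
  rcases v₀ with v | v <;> rfl

/-- The approximants of consecutive orders are linearly independent. -/
theorem intNum_sub_intDen_ne_zero (hω : ω ∉ Set.range ((↑) : ℤ → ℚ)) (hβ : β ≠ 0) {l₀ l₁ : K}
    (hl : (l₀, l₁) ≠ (0, 0)) (n : ℕ) :
    l₀ * intNum ω β n - l₁ * intDen ω β n ≠ 0 ∨
      l₀ * intNum ω β (n + 1) - l₁ * intDen ω β (n + 1) ≠ 0 := by
  by_contra! h
  obtain ⟨h1, h2⟩ := h
  have hdet : intDen ω β n * intNum ω β (n + 1) - intDen ω β (n + 1) * intNum ω β n ≠ 0 := by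
    have e : intDen ω β n * intNum ω β (n + 1) - intDen ω β (n + 1) * intNum ω β n =
        (commonDen ω β n : K) * (commonDen ω β (n + 1) : K) * (-β) *
          (denVal ω (-β) n * numVal ω (-β) (n + 1) - denVal ω (-β) (n + 1) * numVal ω (-β) n) := by
      simp only [intDen, intNum]
      ring
    rw [e]
    have hD : ∀ n, (commonDen ω β n : K) ≠ 0 := fun n =>
      Rat.cast_ne_zero.2 (commonDen_pos ω β n).ne'
    exact mul_ne_zero (mul_ne_zero (mul_ne_zero (hD n) (hD _)) (neg_ne_zero.2 hβ))
      (casoratian_ne_zero hω _ n)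
  have h0 : l₀ * (intDen ω β n * intNum ω β (n + 1) - intDen ω β (n + 1) * intNum ω β n) = 0 := by
    linear_combination intDen ω β n * h2 - intDen ω β (n + 1) * h1
  have h0' : l₁ * (intDen ω β n * intNum ω β (n + 1) - intDen ω β (n + 1) * intNum ω β n) = 0 := by
    linear_combination intNum ω β n * h2 - intNum ω β (n + 1) * h1
  exact hl (Prod.ext ((mul_eq_zero.1 h0).resolve_right hdet)
    ((mul_eq_zero.1 h0').resolve_right hdet))

/-- The quantity `|l₀ (1 - 1 / β) ^ ω - l₁|_{v₀}`. -/
noncomputable def linForm (ω : ℚ) (β : K) (v₀ : Place K) (l₀ l₁ : K) : ℝ :=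
  v₀.nabsCompletion (v₀.coe l₀ * binomValue v₀ ω β - v₀.coe l₁)

/-- Eliminating `(1 - 1 / β) ^ ω` between a linear form and an approximation gives a nonzero element
of `K`; the product formula then bounds the linear form from below. -/
theorem localHeight_le (hω : ω ∉ Set.range ((↑) : ℤ → ℚ)) (v₀ : Place K)
    (hβ : radius ω v₀ < v₀.nabs β) {η : ℝ} (hη : 0 < η) :
    ∃ C, 0 < C ∧ ∀ᶠ n : ℕ in atTop, ∀ l₀ l₁ : K, l₀ * intNum ω β n - l₁ * intDen ω β n ≠ 0 →
      localHeight v₀ l₀ l₁ ≤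
        C * Real.exp (n * (∑ v : InfinitePlace K, growthRate ω β v + η)) * height l₀ l₁ *
          max (linForm ω β v₀ l₀ l₁)
            (localHeight v₀ l₀ l₁ * Real.exp (-(n * gap ω β v₀))) := by
  set η' := η / (Fintype.card (InfinitePlace K)) with hη'
  have hcard : (0 : ℝ) < Fintype.card (InfinitePlace K) := by exact_mod_cast Fintype.card_pos
  have hη'0 : 0 < η' := div_pos hη hcard
  choose c hc hcn using fun v : InfinitePlace K => exists_nabs_inl_le (β := β) hω v hη'0
  set B : ℕ → InfinitePlace K → ℝ := fun n v =>
    2 * (c v * Real.exp (n * (growthRate ω β v + η'))) with hBdef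
  have hBpos : ∀ n v, 0 < B n v := fun n v => by
    have := hc v
    positivity
  -- the approximation at `v₀`
  have hv₀ : ∃ c', 0 < c' ∧ ∀ᶠ n : ℕ in atTop,
      v₀.nabs (intDen ω β n) ≤ c' * Sum.elim (B n) (fun _ => 1) v₀ ∧
      v₀.nabsCompletion (v₀.coeHom (intDen ω β n) * binomValue v₀ ω β -
        v₀.coeHom (intNum ω β n)) ≤
          c' * Sum.elim (B n) (fun _ => 1) v₀ * Real.exp (-(n * gap ω β v₀)) := by
    rcases v₀ with v | v
    · obtain ⟨a, ha, han⟩ := exists_nabsCompletion_inl_le hω v hβ hη'0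
      have hcv := hc v
      refine ⟨1 + a / c v, by positivity, ?_⟩
      filter_upwards [han, hcn v] with n h1 h2
      have hE := Real.exp_pos (n * (growthRate ω β v + η'))
      have hB1 : c v * Real.exp (n * (growthRate ω β v + η')) ≤ B n v := by
        simp only [hBdef]
        linarith [mul_pos hcv hE]
      have hB0 := hBpos n v
      constructor
      · refine h2.1.trans (hB1.trans ?_)
        exact le_mul_of_one_le_left hB0.le (le_add_of_nonneg_right (by positivity))
      · refine h1.trans ?_
        rw [show (n : ℝ) * (growthRate ω β v - gap ω β (.inl v) + η') =
          n * (growthRate ω β v + η') + -(n * gap ω β (.inl v)) by ring, Real.exp_add, ← mul_assoc]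
        refine mul_le_mul_of_nonneg_right ?_ (Real.exp_pos _).le
        calc a * Real.exp (n * (growthRate ω β v + η')) =
              a / c v * (c v * Real.exp (n * (growthRate ω β v + η'))) := by field_simp
          _ ≤ (1 + a / c v) * B n v := by
              gcongr
              exact le_add_of_nonneg_left one_pos.le
    · refine ⟨1, one_pos, Eventually.of_forall fun n => ⟨?_, ?_⟩⟩
      · simpa using nabs_inr_le_one_of_isIntegral v (isIntegral_intDen hω n)
      · have h := nabsCompletion_inr_le hω v hβ n
        have hpos := finiteDecay_pos (ω := ω) v (ne_zero_of_radius_lt hβ)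
        rw [gap, mul_neg, neg_neg, Real.exp_nat_mul, Real.exp_log hpos]
        simpa using h
  obtain ⟨c', hc', hc'n⟩ := hv₀
  have hP : 0 < ∏ v, 2 * c v := Finset.prod_pos fun v _ => mul_pos two_pos (hc v)
  refine ⟨2 * c' * ∏ v, 2 * c v, by positivity, ?_⟩
  filter_upwards [hc'n, eventually_all.2 hcn] with n h0 hinf l₀ l₁ hδ
  set b₀ := Sum.elim (B n) (fun _ => 1) v₀ with hb₀
  have hb₀pos : 0 < b₀ := by
    rcases v₀ with v | v
    · exact hBpos n v
    · exact one_pos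
  have hLpos : 0 < localHeight v₀ l₀ l₁ := one_pos.trans_le (one_le_localHeight _ _ _)
  have key := mul_localHeight_le v₀ hδ l₀ l₁ (B n) (hBpos n) (fun v _ => by
      refine (Place.nabs_sub_le _ _ _).trans ?_
      rw [Place.nabs_mul, Place.nabs_mul, hBdef, mul_assoc]
      have hE := mul_pos (hc v) (Real.exp_pos (n * (growthRate ω β v + η')))
      refine mul_le_mul_of_nonneg_left (max_le ?_ ?_) two_pos.le
      · rw [mul_comm]
        exact mul_le_mul (hinf v).2 (nabs_le_localHeight_left _ _ _) (Place.nabs_nonneg _ _) hE.le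
      · rw [mul_comm]
        exact mul_le_mul (hinf v).1 (nabs_le_localHeight_right _ _ _) (Place.nabs_nonneg _ _)
          hE.le)
    (fun v _ => by
      rw [sub_eq_add_neg]
      refine (nabs_inr_add_le v _ _).trans ?_
      rw [Place.nabs_neg, Place.nabs_mul, Place.nabs_mul]
      refine max_le ?_ ?_
      · exact (mul_le_of_le_one_right (Place.nabs_nonneg _ _)
          (nabs_inr_le_one_of_isIntegral v (isIntegral_intNum hω n))).trans
            (nabs_le_localHeight_left _ _ _)
      · exact (mul_le_of_le_one_right (Place.nabs_nonneg _ _)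
          (nabs_inr_le_one_of_isIntegral v (isIntegral_intDen hω n))).trans
            (nabs_le_localHeight_right _ _ _))
  set M := max (linForm ω β v₀ l₀ l₁)
    (localHeight v₀ l₀ l₁ * Real.exp (-(n * gap ω β v₀))) with hM
  have hΛ : 0 ≤ linForm ω β v₀ l₀ l₁ := v₀.nabsCompletion_nonneg _
  have hδv₀ : v₀.nabs (l₀ * intNum ω β n - l₁ * intDen ω β n) ≤ 2 * (c' * b₀ * M) := by
    have e : v₀.coeHom (l₀ * intNum ω β n - l₁ * intDen ω β n) =
        v₀.coeHom (intDen ω β n) * (v₀.coe l₀ * binomValue v₀ ω β - v₀.coe l₁) -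
        v₀.coeHom l₀ * (v₀.coeHom (intDen ω β n) * binomValue v₀ ω β -
          v₀.coeHom (intNum ω β n)) := by
      rw [v₀.coe_eq_coeHom, v₀.coe_eq_coeHom, map_sub, map_mul, map_mul]
      ring
    rw [← v₀.nabsCompletion_coeHom, e]
    refine (v₀.nabsCompletion_sub_le _ _).trans (mul_le_mul_of_nonneg_left (max_le ?_ ?_)
      two_pos.le)
    · rw [v₀.nabsCompletion_mul, v₀.nabsCompletion_coeHom]
      exact mul_le_mul h0.1 (le_max_left _ _) hΛ (by positivity)
    · rw [v₀.nabsCompletion_mul, v₀.nabsCompletion_coeHom]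
      calc _ ≤ localHeight v₀ l₀ l₁ * (c' * b₀ * Real.exp (-(n * gap ω β v₀))) :=
            mul_le_mul (nabs_le_localHeight_left _ _ _) h0.2 (v₀.nabsCompletion_nonneg _) hLpos.le
        _ = c' * b₀ * (localHeight v₀ l₀ l₁ * Real.exp (-(n * gap ω β v₀))) := by ring
        _ ≤ _ := by
            gcongr
            exact le_max_right _ _
  have hprodB : ∏ v, B n v =
      (∏ v, 2 * c v) * Real.exp (n * (∑ v : InfinitePlace K, growthRate ω β v + η)) := by
    have hs : ∑ v : InfinitePlace K, growthRate ω β v + η =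
        ∑ v : InfinitePlace K, (growthRate ω β v + η') := by
      rw [Finset.sum_add_distrib, Finset.sum_const, Finset.card_univ, nsmul_eq_mul, hη',
        mul_div_cancel₀ _ hcard.ne']
    rw [hs, Finset.mul_sum, Real.exp_sum, ← Finset.prod_mul_distrib]
    refine Finset.prod_congr rfl fun v _ => ?_
    simp only [hBdef]
    ring
  have hH := one_pos.le.trans (one_le_height l₀ l₁)
  have hPB : 0 ≤ ∏ v, B n v := (Finset.prod_pos fun v _ => hBpos n v).le
  have hfin := key.trans (mul_le_mul_of_nonneg_right hδv₀ (mul_nonneg hPB hH))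
  rw [hprodB] at hfin
  refine le_of_mul_le_mul_left (hfin.trans (le_of_eq ?_)) hb₀pos
  ring

/-- The total growth of the approximants is nonnegative, by the fundamental inequality for the
fixed form `(1, 0)`. -/
theorem sum_growthRate_nonneg (hω : ω ∉ Set.range ((↑) : ℤ → ℚ)) (v₀ : Place K)
    (hβ : radius ω v₀ < v₀.nabs β) (hV : 0 < V ω β v₀) :
    0 ≤ ∑ v : InfinitePlace K, growthRate ω β v := by
  by_contra! hneg
  set τ := ∑ v : InfinitePlace K, growthRate ω β v with hτ
  have hVe := V_eq (ω := ω) (β := β) v₀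
  obtain ⟨η, hη, hη1, hη2⟩ : ∃ η : ℝ, 0 < η ∧ τ + η ≤ -η ∧ η ≤ V ω β v₀ - η := by
    refine ⟨min (-τ) (V ω β v₀) / 2, by
      have := lt_min (neg_pos.2 hneg) hV
      positivity, ?_, ?_⟩
    · linarith [min_le_left (-τ) (V ω β v₀)]
    · linarith [min_le_right (-τ) (V ω β v₀)]
  obtain ⟨C, hC, h⟩ := localHeight_le hω v₀ hβ hη
  set L := localHeight v₀ (1 : K) 0 with hL
  set H := height (1 : K) 0 with hH
  set Λ := linForm ω β v₀ 1 0 with hΛ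
  have hΛ0 : 0 ≤ Λ := v₀.nabsCompletion_nonneg _
  have hL1 : 1 ≤ L := one_le_localHeight _ _ _
  have hH1 : 1 ≤ H := one_le_height _ _
  have hbound : ∃ᶠ n : ℕ in atTop, 1 ≤ C * H * (Λ + L) * Real.exp (-η) ^ n := by
    have hfreq : ∃ᶠ n : ℕ in atTop,
        (1 : K) * intNum ω β n - 0 * intDen ω β n ≠ 0 := by
      rw [frequently_atTop]
      intro N
      rcases intNum_sub_intDen_ne_zero hω (ne_zero_of_radius_lt hβ)
        (l₀ := (1 : K)) (l₁ := 0) (by simp) N with h | h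
      · exact ⟨N, le_rfl, h⟩
      · exact ⟨N + 1, by omega, h⟩
    refine (hfreq.and_eventually h).mono fun n hn => ?_
    have hn2 := hn.2 1 0 hn.1
    have hn0 : (0 : ℝ) ≤ n := Nat.cast_nonneg n
    rw [← hL, ← hH, ← hΛ] at hn2
    refine (hL1.trans hn2).trans ?_
    have e1 : Real.exp (n * (τ + η)) * max Λ (L * Real.exp (-(n * gap ω β v₀))) ≤
        (Λ + L) * Real.exp (-η) ^ n := by
      rw [← Real.exp_nat_mul]
      have m2 : Real.exp (n * (τ + η)) * Real.exp (-(n * gap ω β v₀)) ≤ Real.exp (n * -η) := by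
        rw [← Real.exp_add]
        refine Real.exp_le_exp.2 ?_
        have := mul_le_mul_of_nonneg_left (show τ + η - gap ω β v₀ ≤ -η by linarith) hn0
        linarith
      rw [mul_max_of_nonneg _ _ (Real.exp_pos _).le]
      refine max_le ?_ ?_
      · calc _ ≤ Real.exp (n * -η) * Λ := by gcongr
          _ ≤ _ := by nlinarith [Real.exp_pos (n * -η)]
      · calc _ = L * (Real.exp (n * (τ + η)) * Real.exp (-(n * gap ω β v₀))) := by ring
          _ ≤ L * Real.exp (n * -η) := by gcongr
          _ ≤ _ := by nlinarith [mul_nonneg hΛ0 (Real.exp_pos (n * -η)).le]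
    calc _ = C * H * (Real.exp (n * (τ + η)) * max Λ (L * Real.exp (-(n * gap ω β v₀)))) := by
          ring
      _ ≤ C * H * ((Λ + L) * Real.exp (-η) ^ n) := by gcongr
      _ = _ := by ring
  have hlim : Tendsto (fun n : ℕ => C * H * (Λ + L) * Real.exp (-η) ^ n) atTop (𝓝 0) := by
    have := (tendsto_pow_atTop_nhds_zero_of_lt_one (Real.exp_pos (-η)).le
      (Real.exp_lt_one_iff.2 (neg_lt_zero.2 hη))).const_mul (C * H * (Λ + L))
    rwa [mul_zero] at this
  exact hbound ((hlim.eventually_lt_const one_pos).mono fun n hn => not_le.2 hn)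

end Inequality

end BinomPade

/-! ### Choice of the order of approximation -/

theorem mainTheorem12 {K : Type*} [Field K] [NumberField K]
    (ω : ℚ) (hω : ω ∉ Set.range ((↑) : ℤ → ℚ))
    (v₀ : BinomPade.Place K) (β : K)
    (hβ : BinomPade.radius ω v₀ < v₀.nabs β)
    (hV : 0 < BinomPade.V ω β v₀)
    (ε : ℝ) (hε : 0 < ε) (hεV : ε < BinomPade.V ω β v₀) :
    ∃ H₀ : ℝ, 0 < H₀ ∧ ∀ l₀ l₁ : K, (l₀, l₁) ≠ (0, 0) → H₀ ≤ BinomPade.height l₀ l₁ →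
      BinomPade.C ω β v₀ ε * BinomPade.localHeight v₀ l₀ l₁ *
          BinomPade.height l₀ l₁ ^ (-BinomPade.mu ω β v₀ ε) <
        v₀.nabsCompletion (v₀.coe l₀ * BinomPade.binomValue v₀ ω β - v₀.coe l₁) := by
  have hVe := BinomPade.V_eq (ω := ω) (β := β) v₀
  have hτ := BinomPade.sum_growthRate_nonneg hω v₀ hβ hV
  set τ := ∑ v : InfinitePlace K, BinomPade.growthRate ω β v with hτdef
  set W := BinomPade.V ω β v₀ with hW
  set g := BinomPade.gap ω β v₀ with hg
  have hg0 : 0 < g := by linarith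
  set η := ε / 2 with hηdef
  have hη : 0 < η := half_pos hε
  have hWη : 0 < W - η := by linarith
  obtain ⟨C, hC, hCn⟩ := BinomPade.localHeight_le hω v₀ hβ hη
  obtain ⟨N, hN⟩ := Filter.eventually_atTop.1 hCn
  set D := max C 1 with hD
  have hD1 : 1 ≤ D := le_max_right _ _
  have hD0 : 0 < D := one_pos.trans_le hD1
  set κ := (τ + η) / (W - η) with hκ
  have hκg : 1 + κ = g / (W - η) := by
    rw [hκ, eq_div_iff hWη.ne', add_mul, div_mul_cancel₀ _ hWη.ne']
    linarith
  have hμ : 0 < g / (W - ε) - (1 + κ) := by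
    rw [hκg]
    exact sub_pos.2 (div_lt_div_of_pos_left hg0 (by linarith) (by linarith))
  set c₁ := D * D ^ κ * Real.exp (2 * (τ + η)) with hc₁
  set c₂ := BinomPade.C ω β v₀ ε with hc₂
  -- for large heights the loss in the exponent absorbs all constants
  obtain ⟨H₁, hH₁⟩ := Filter.eventually_atTop.1
    (((tendsto_rpow_atTop hμ).eventually_gt_atTop (c₂ * c₁)).and
      (Filter.eventually_ge_atTop (max 1 (Real.exp (N * (W - η))))))
  refine ⟨max H₁ 1, by positivity, fun l₀ l₁ hl hHge => ?_⟩
  set H := BinomPade.height l₀ l₁ with hH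
  obtain ⟨hHlarge, hHge'⟩ := hH₁ H ((le_max_left _ _).trans hHge)
  have hH1 : 1 ≤ H := (le_max_left _ _).trans hHge'
  have hHexp : Real.exp (N * (W - η)) ≤ H := (le_max_right _ _).trans hHge'
  have hH0 : 0 < H := one_pos.trans_le hH1
  set L := BinomPade.localHeight v₀ l₀ l₁ with hL
  have hL0 : 0 < L := one_pos.trans_le (BinomPade.one_le_localHeight _ _ _)
  set Λ := v₀.nabsCompletion (v₀.coe l₀ * BinomPade.binomValue v₀ ω β - v₀.coe l₁) with hΛ
  have hΛ0 : 0 ≤ Λ := v₀.nabsCompletion_nonneg _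
  set x := Real.log (D * H) / (W - η) with hx
  have hNx : (N : ℝ) ≤ x := by
    rw [hx, le_div_iff₀ hWη, Real.le_log_iff_exp_le (by positivity)]
    exact hHexp.trans (le_mul_of_one_le_left hH0.le hD1)
  have hx0 : 0 ≤ x := (Nat.cast_nonneg N).trans hNx
  -- `n` is the least order for which the remainder is negligible, or the next one
  obtain ⟨n, hnx, hnx2, hδ⟩ : ∃ n : ℕ, x < n ∧ (n : ℝ) ≤ x + 2 ∧
      l₀ * BinomPade.intNum ω β n - l₁ * BinomPade.intDen ω β n ≠ 0 := by
    have h1 := Nat.lt_floor_add_one x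
    have h2 := Nat.floor_le hx0
    rcases BinomPade.intNum_sub_intDen_ne_zero hω (BinomPade.ne_zero_of_radius_lt hβ) hl
      (⌊x⌋₊ + 1) with h | h
    · exact ⟨_, by push_cast; linarith, by push_cast; linarith, h⟩
    · exact ⟨_, by push_cast; linarith, by push_cast; linarith, h⟩
  have hNn : N ≤ n := by exact_mod_cast (hNx.trans hnx.le)
  have hmain := hN n hNn l₀ l₁ hδ
  have hmain' : L ≤ D * Real.exp (n * (τ + η)) * H * max Λ (L * Real.exp (-(n * g))) := by
    refine hmain.trans ?_
    have hmax : 0 ≤ max Λ (L * Real.exp (-(n * g))) := hΛ0.trans (le_max_left _ _)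
    refine mul_le_mul_of_nonneg_right ?_ hmax
    gcongr
    exact le_max_left _ _
  have hsmall : D * Real.exp (n * (τ + η)) * H * (L * Real.exp (-(n * g))) < L := by
    have h1 : D * H < Real.exp (n * (W - η)) := by
      rw [← Real.log_lt_iff_lt_exp (by positivity), ← div_lt_iff₀ hWη]
      exact hnx
    have h2 : Real.exp (n * (τ + η)) * Real.exp (-(n * g)) = (Real.exp (n * (W - η)))⁻¹ := by
      rw [← Real.exp_add, ← Real.exp_neg]
      congr 1
      rw [hVe]
      ring
    calc _ = D * H * (Real.exp (n * (τ + η)) * Real.exp (-(n * g))) * L := by ring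
      _ = D * H / Real.exp (n * (W - η)) * L := by rw [h2, div_eq_mul_inv]
      _ < 1 * L := by
          gcongr
          exact (div_lt_one (Real.exp_pos _)).2 h1
      _ = L := one_mul L
  have hfirst : L ≤ D * Real.exp (n * (τ + η)) * H * Λ := by
    rcases le_total Λ (L * Real.exp (-(n * g))) with h | h
    · rw [max_eq_right h] at hmain'
      exact absurd (hmain'.trans_lt hsmall) (lt_irrefl _)
    · rwa [max_eq_left h] at hmain'
  have hexp : Real.exp (n * (τ + η)) ≤ D ^ κ * H ^ κ * Real.exp (2 * (τ + η)) := by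
    rw [← Real.mul_rpow hD0.le hH0.le, Real.rpow_def_of_pos (by positivity), ← Real.exp_add]
    refine Real.exp_le_exp.2 ?_
    have h1 : (n : ℝ) * (τ + η) ≤ (x + 2) * (τ + η) :=
      mul_le_mul_of_nonneg_right hnx2 (by linarith)
    have h2 : x * (τ + η) = Real.log (D * H) * κ := by
      rw [hx, hκ]
      ring
    linarith
  have hlow : L ≤ c₁ * H ^ (1 + κ) * Λ := by
    rw [Real.rpow_add hH0, Real.rpow_one]
    calc L ≤ D * Real.exp (n * (τ + η)) * H * Λ := hfirst
      _ ≤ D * (D ^ κ * H ^ κ * Real.exp (2 * (τ + η))) * H * Λ := by gcongr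
      _ = _ := by rw [hc₁]; ring
  have hμe : BinomPade.mu ω β v₀ ε = g / (W - ε) := BinomPade.mu_eq v₀ ε
  rw [hμe]
  have hHk : 0 < H ^ (1 + κ) := Real.rpow_pos_of_pos hH0 _
  rw [Real.rpow_sub hH0, lt_div_iff₀ hHk] at hHlarge
  have hHg : 0 < H ^ (g / (W - ε)) := Real.rpow_pos_of_pos hH0 _
  rw [Real.rpow_neg hH0.le, ← div_eq_mul_inv, div_lt_iff₀ hHg]
  have hΛpos : 0 < Λ := by
    refine hΛ0.lt_of_ne fun h => ?_
    rw [← h, mul_zero] at hlow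
    linarith
  have hCpos : 0 < c₂ := by
    rcases v₀ with v | v
    · exact mul_pos (Real.exp_pos _) (Real.exp_pos _)
    · exact mul_pos (Real.exp_pos _)
        (BinomPade.finiteDecay_pos v (BinomPade.ne_zero_of_radius_lt hβ))
  calc c₂ * L ≤ c₂ * (c₁ * H ^ (1 + κ) * Λ) := by gcongr
    _ = c₂ * c₁ * H ^ (1 + κ) * Λ := by ring
    _ < H ^ (g / (W - ε)) * Λ := by gcongr
    _ = _ := mul_comm _ _
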